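/- Let $\mathcal{M}_n$ be the complex $n\times n$ matrices and let $\mathcal{E}:\mathcal{M}_n\to\mathcal{M}_n$ be a linear map that is trace preserving and positivity improving (i.e. $\mathcal{E}(A)>0$ for every nonzero $A\geq 0$). Let $\mathcal{E}^*$ be the adjoint for the Hilbert-Schmidt inner product. A map $\mathcal{T}$ is doubly stochastic if $\mathcal{T}(1)=\mathcal{T}^*(1)=1$. The operator Sinkhorn iteration is $\mathcal{E}_0=\mathcal{E}$ and $$\mathcal{E}_{2i+1}(\cdot)=\mathcal{E}_{2i}(1)^{-1/2}\,\mathcal{E}_{2i}(\cdot)\,\mathcal{E}_{2i}(1)^{-1/2},\qquad \mathcal{E}_{2i+2}(\cdot)=\mathcal{E}_{2i+1}\big(\mathcal{E}_{2i+1}^*(1)^{-1/2}\cdot\,\mathcal{E}_{2i+1}^*(1)^{-1/2}\big).$$ Write $\mathcal{E}^{(k)}=\mathcal{E}_{2k}$ and $\mathcal{E}^{(k)\prime}=\mathcal{E}_{2k+1}$ for $k\ge 0$, and $\rho^{(1)}=\mathcal{E}(1)$. Let $\sigma^{(1)}$ be either of $\mathcal{E}_1^*(1)$ and $\mathcal{E}_3^*(1)$.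 For positive semidefinite $x,y$, not both zero, with $x\le\alpha y$ and $y\le\beta x$ for some $\alpha,\beta>0$, let $d_H(x,y)=\ln\big(\inf\{\beta>0: x\le\beta y\}/\sup\{\alpha>0:\alpha y\le x\}\big)$ be Hilbert's projective metric; put $d_H(0,0)=0$ and $d_H(x,y)=\infty$ otherwise. Let $\gamma=\gamma(\mathcal{E})$ be the square of the contraction ratio $$\gamma^{1/2}(\mathcal{E})=\sup\Big\{\frac{d_H(\mathcal{E}(x),\mathcal{E}(y))}{d_H(x,y)} : x,y\ge 0,\ 0<d_H(x,y)<\infty\Big\}$$ (with $\sup\emptyset=0$). For maps $\mathcal{F},\mathcal{T}$ on $\mathcal{M}_n$ let $\Delta(\mathcal{F},\mathcal{T})$ be the infimum of $d_H(|X|,1)+d_H(|Y|,1)$ over all invertible $X,Y$ with $\mathcal{T}(\cdot)=Y\mathcal{F}(X\cdot X^\dagger)Y^\dagger$, where $|X|=(X^\dagger X)^{1/2}$ (so $|X|=X$ for $X>0$), and $\infty$ if there are no such $X,Y$. Then the maps $\mathcal{E}_i$ converge as $i\to\infty$ to a doubly stochastic map $\mathcal{T}$, which is a scaling $\mathcal{T}=Y\mathcal{E}(X\cdot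 X^\dagger)Y^\dagger$ of $\mathcal{E}$ with invertible $X,Y$. It is the unique doubly stochastic scaling of $\mathcal{E}$ up to unitaries: if $Y'\mathcal{E}(X'\cdot X'^\dagger)Y'^\dagger$ is doubly stochastic for some $X',Y'\in\mathcal{M}_n$, then it equals $U\mathcal{T}(V\cdot V^\dagger)U^\dagger$ for some unitary $U,V$. Moreover $\gamma<1$, the numbers $d_H(\rho^{(1)},1)$ and $d_H(\sigma^{(1)},1)$ are finite, and for every $k\ge 0$ $$\Delta(\mathcal{E}^{(k)},\mathcal{T})\le\frac{\gamma^k}{1-\gamma}\big(d_H(\rho^{(1)},1)+d_H(\sigma^{(1)},1)\big),\qquad \Delta(\mathcal{E}^{(k)\prime},\mathcal{T})\le\frac{\gamma^k}{1-\gamma}\big(d_H(\rho^{(1)},1)+d_H(\sigma^{(1)},1)\big),$$ so the convergence is geometric. -/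

import Mathlib

open Filter Topology
open scoped ENNReal Matrix MatrixOrder ComplexOrder

noncomputable section

namespace OperatorSinkhorn

/-- The algebra of complex `n × n` matrices. -/
abbrev Mat (n : ℕ) : Type := Matrix (Fin n) (Fin n) ℂ

/-- Linear maps on complex `n × n` matrices. -/
abbrev MatMap (n : ℕ) : Type := Mat n →ₗ[ℂ] Mat n

variable {n : ℕ}

/-- `E` sends every nonzero positive semidefinite matrix to a positive definite one. -/
def PositivityImproving (E : MatMap n) : Prop :=
  ∀ A : Mat n, A.PosSemidef → A ≠ 0 → (E A).PosDef

/-- `E` preserves the trace. -/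
def TracePreserving (E : MatMap n) : Prop :=
  ∀ A : Mat n, (E A).trace = A.trace

/-- The adjoint of `E` for the Hilbert-Schmidt inner product `⟨A, B⟩ = tr (Aᴴ B)`. -/
def adjointMap (E : MatMap n) : MatMap n where
  toFun B := Matrix.of fun i j => star ((Bᴴ * E (Matrix.single i j 1)).trace)
  map_add' A B := by
    ext i j
    simp [Matrix.add_mul]
  map_smul' c A := by
    ext i j
    simp

/-- The defining property of the adjoint: `⟨E* B, A⟩ = ⟨B, E A⟩`. -/
theorem trace_adjointMap (E : MatMap n) (A B : Mat n) :
    ((adjointMap E B)ᴴ * A).trace = (Bᴴ * E A).trace := by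
  have h : A = ∑ i, ∑ j, A i j • Matrix.single i j (1 : ℂ) := by
    conv_lhs => rw [Matrix.matrix_eq_sum_single A]
    simp [Matrix.smul_single]
  conv_rhs => rw [h]
  simp only [map_sum, map_smul, Matrix.mul_sum, Matrix.trace_sum, Matrix.mul_smul,
    Matrix.trace_smul, smul_eq_mul]
  rw [Matrix.trace, Finset.sum_comm]
  refine Finset.sum_congr rfl fun j _ => ?_
  rw [Matrix.diag_apply, Matrix.mul_apply]
  refine Finset.sum_congr rfl fun i _ => ?_
  simp [adjointMap, mul_comm]

/-- `E` is doubly stochastic: unital with unital adjoint. -/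
def DoublyStochastic (E : MatMap n) : Prop :=
  E 1 = 1 ∧ adjointMap E 1 = 1

/-- The scaling `A ↦ Y E(X A Xᴴ) Yᴴ` of `E`. -/
def scaling (E : MatMap n) (X Y : Mat n) : MatMap n where
  toFun A := Y * E (X * A * Xᴴ) * Yᴴ
  map_add' A B := by simp [Matrix.mul_add, Matrix.add_mul]
  map_smul' c A := by simp

/-- The inverse square root `A^{-1/2}` (used for positive definite `A`). -/
def invSqrt (A : Mat n) : Mat n := (CFC.sqrt A)⁻¹

/-- One step making the map unital: `A ↦ E(1)^{-1/2} E(A) E(1)^{-1/2}`. -/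
def unitalStep (E : MatMap n) : MatMap n where
  toFun A := invSqrt (E 1) * E A * invSqrt (E 1)
  map_add' A B := by simp [Matrix.mul_add, Matrix.add_mul]
  map_smul' c A := by simp

/-- One step making the map trace preserving: `A ↦ E(E*(1)^{-1/2} A E*(1)^{-1/2})`. -/
def traceStep (E : MatMap n) : MatMap n where
  toFun A := E (invSqrt (adjointMap E 1) * A * invSqrt (adjointMap E 1))
  map_add' A B := by simp [Matrix.mul_add, Matrix.add_mul]
  map_smul' c A := by simp

/-- The operator Sinkhorn iteration `E_0 = E, E_1, E_2, …`. -/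
def sinkhorn (E : MatMap n) : ℕ → MatMap n
  | 0 => E
  | i + 1 => if Even i then unitalStep (sinkhorn E i) else traceStep (sinkhorn E i)

/-- Two positive semidefinite matrices that bound each other up to positive factors. -/
def Comparable (x y : Mat n) : Prop :=
  x.PosSemidef ∧ y.PosSemidef ∧
    (∃ α : ℝ, 0 < α ∧ (α • y - x).PosSemidef) ∧ (∃ β : ℝ, 0 < β ∧ (β • x - y).PosSemidef)

/-- `M(x/y) = inf {β > 0 : x ≤ β y}`. -/
def hilbertSup (x y : Mat n) : ℝ := sInf {β : ℝ | 0 < β ∧ (β • y - x).PosSemidef}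

/-- `m(x/y) = sup {α > 0 : α y ≤ x}`. -/
def hilbertInf (x y : Mat n) : ℝ := sSup {α : ℝ | 0 < α ∧ (x - α • y).PosSemidef}

open Classical in
/-- Hilbert's projective metric on the cone of positive semidefinite matrices, with values in
`[0, ∞]`: `log (M(x/y) / m(x/y))` for comparable matrices, `0` at `(0, 0)`, `∞` otherwise. -/
def dH (x y : Mat n) : ℝ≥0∞ :=
  if x = 0 ∧ y = 0 then 0
  else if Comparable x y then ENNReal.ofReal (Real.log (hilbertSup x y / hilbertInf x y))
  else ⊤

/-- The contraction ratio of `E`: the supremum of `d_H(E x, E y) / d_H(x, y)` over all positive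
semidefinite `x`, `y` for which the denominator is neither `0` nor `∞`. -/
def contractionRatio (E : MatMap n) : ℝ≥0∞ :=
  ⨆ (x : Mat n) (y : Mat n) (_ : x.PosSemidef) (_ : y.PosSemidef)
    (_ : dH x y ≠ 0) (_ : dH x y ≠ ⊤), dH (E x) (E y) / dH x y

/-- The square of the contraction ratio. -/
def gamma (E : MatMap n) : ℝ≥0∞ := contractionRatio E ^ 2

/-- The distance `Δ(E, T)` of two maps: `d_H(|X|, 1) + d_H(|Y|, 1)` if `T = Y E(X · Xᴴ) Yᴴ` with
invertible `X`, `Y` (the infimum over all such pairs), and `∞` if there are none. Here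
`|X| = (Xᴴ X)^{1/2}`, so `|X| = X` for positive definite `X`. -/
def scalingDist (E T : MatMap n) : ℝ≥0∞ :=
  ⨅ (X : Mat n) (Y : Mat n) (_ : IsUnit X) (_ : IsUnit Y) (_ : T = scaling E X Y),
    dH (CFC.abs X) 1 + dH (CFC.abs Y) 1

end OperatorSinkhorn

end

/-! The mechanism is Birkhoff-Hopf contraction in Hilbert's projective metric. By compactness, a
positivity improving map has cross ratios `pair f (F u) * pair g (F v) / (pair f (F v) * pair g (F
u))` bounded by some `k ^ 2`, and then it contracts the metric by `(k - 1) / (k + 1) < 1`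
(`CrossRatioBound.contracts`). Conversely, contraction by `c < 1` bounds cross ratios by `((1 + c) /
(1 - c)) ^ 2` (`Contracts.crossRatioBound`). Cross-ratio bounds survive scalings and adjoints, so
the contraction ratio `c` of `E` serves every iterate and its adjoint.

If `E*(1) = 1`, the next step changes the adjoint marginal to `E*(E(1)⁻¹)`. Inversion preserves the
distance to `1`, so the error shrinks by `c`; the other step is dual. Hence the errors at
`E_{2k}(1)` and `E_{2k+1}*(1)` are at most `t c^{2k}` and `c t c^{2k}`, with `t = d_H(E(1), 1)`.
Trace normalization turns these projective bounds into norm bounds. The accumulated factors and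
their inverses therefore converge, and summing the tails geometrically bounds the distance to the
limit (`exists_tendsto_prod_invSqrt`).

For uniqueness, a doubly stochastic scaling of the limit `T` by `Z`, `W` gives `T(P) = Q⁻¹` and
`T*(Q) = P⁻¹` for `P = Z Zᴴ`, `Q = Wᴴ W`. The round trip contracts, so `P` and `Q` are scalar. -/

namespace OperatorSinkhorn

variable {n : ℕ}

/-- The real Hilbert-Schmidt pairing `Re tr (f X)`. -/
noncomputable def pair (f X : Mat n) : ℝ := (f * X).trace.re

/-! ### The trace pairing and self-duality of the positive semidefinite cone -/

section Pairing

theorem exists_eq_conjTranspose_mul_self {A : Mat n} (hA : A.PosSemidef) :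
    ∃ B : Mat n, A = Bᴴ * B :=
  CStarAlgebra.nonneg_iff_eq_star_mul_self.1 hA.nonneg

theorem pair_comm (f X : Mat n) : pair f X = pair X f := by
  rw [pair, pair, Matrix.trace_mul_comm]

theorem pair_add (f X Y : Mat n) : pair f (X + Y) = pair f X + pair f Y := by
  simp [pair, Matrix.mul_add]

theorem pair_sub (f X Y : Mat n) : pair f (X - Y) = pair f X - pair f Y := by
  simp [pair, Matrix.mul_sub]

theorem pair_smul (f X : Mat n) (a : ℝ) : pair f (a • X) = a * pair f X := by
  simp [pair]

theorem pair_conjTranspose_mul_self (B X : Mat n) :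
    pair (Bᴴ * B) X = (B * X * Bᴴ).trace.re := by
  rw [pair, Matrix.mul_assoc, Matrix.trace_mul_comm]

theorem pair_nonneg {f X : Mat n} (hf : f.PosSemidef) (hX : X.PosSemidef) : 0 ≤ pair f X := by
  obtain ⟨B, rfl⟩ := exists_eq_conjTranspose_mul_self hf
  rw [pair_conjTranspose_mul_self]
  exact (Complex.le_def.1 (hX.mul_mul_conjTranspose_same B).trace_nonneg).1

theorem pair_pos {f X : Mat n} (hf : f.PosSemidef) (hf0 : f ≠ 0) (hX : X.PosDef) :
    0 < pair f X := by
  obtain ⟨B, rfl⟩ := exists_eq_conjTranspose_mul_self hf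
  have hp := hX.posSemidef.mul_mul_conjTranspose_same B
  refine lt_of_le_of_ne (pair_nonneg hf hX.posSemidef) fun h => hf0 ?_
  rw [pair_conjTranspose_mul_self] at h
  have h0 : (B * X * Bᴴ).trace = 0 := by
    have h1 := Complex.le_def.1 hp.trace_nonneg
    exact Complex.ext h.symm h1.2.symm
  rw [hp.trace_eq_zero_iff] at h0
  obtain ⟨C, hC⟩ := exists_eq_conjTranspose_mul_self hX.posSemidef
  have hCu : IsUnit (Cᴴ * C) := hC ▸ hX.isUnit
  have h2 : (C * Bᴴ)ᴴ * (C * Bᴴ) = 0 := by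
    rw [← h0, hC]; simp [Matrix.mul_assoc]
  rw [Matrix.conjTranspose_mul_self_eq_zero] at h2
  have h3 : (Cᴴ * C) * Bᴴ = 0 := by rw [Matrix.mul_assoc, h2, Matrix.mul_zero]
  rw [hCu.mul_right_eq_zero.1 h3, Matrix.zero_mul]

theorem pair_vecMulVec (w : Fin n → ℂ) (X : Mat n) :
    pair (Matrix.vecMulVec w (star w)) X = (star w ⬝ᵥ (X *ᵥ w)).re := by
  rw [pair, Matrix.vecMulVec_mul, Matrix.trace_vecMulVec, dotProduct_comm,
    Matrix.dotProduct_mulVec]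

theorem posSemidef_of_pair {X : Mat n} (hX : X.IsHermitian)
    (h : ∀ f : Mat n, f.PosSemidef → 0 ≤ pair f X) : X.PosSemidef := by
  refine Matrix.PosSemidef.of_dotProduct_mulVec_nonneg hX fun w => ?_
  have h1 := h _ (Matrix.posSemidef_vecMulVec_self_star w)
  rw [pair_vecMulVec] at h1
  exact Complex.le_def.2 ⟨h1, (hX.im_star_dotProduct_mulVec_self w).symm⟩

/-- Over `ℂ` a quadratic form with real values already forces Hermiticity. This spares a separate
proof that adjoint maps preserve Hermitian matrices. -/
theorem posSemidef_of_forall_nonneg {X : Mat n} (h : ∀ w : Fin n → ℂ, 0 ≤ star w ⬝ᵥ (X *ᵥ w)) :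
    X.PosSemidef := by
  rw [← Matrix.isPositive_toEuclideanLin_iff, LinearMap.isPositive_iff_complex]
  intro x
  have h1 := Complex.le_def.1 (h x.ofLp)
  have h2 : inner ℂ (X.toEuclideanLin x) x = star (star x.ofLp ⬝ᵥ (X *ᵥ x.ofLp)) := by
    rw [← inner_conj_symm]
    simp [EuclideanSpace.inner_eq_star_dotProduct, dotProduct_comm]
  rw [h2]
  refine ⟨?_, ?_⟩
  · refine Complex.ext ?_ ?_
    · simp
    · simpa using h1.2.symm
  · simpa using h1.1

end Pairing

/-- `E` maps positive semidefinite matrices to positive semidefinite ones. -/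
def Positive (E : MatMap n) : Prop := ∀ A : Mat n, A.PosSemidef → (E A).PosSemidef

theorem PositivityImproving.positive {E : MatMap n} (hE : PositivityImproving E) : Positive E := by
  intro A hA
  by_cases h : A = 0
  · rw [h, map_zero]; exact Matrix.PosSemidef.zero
  · exact (hE A hA h).posSemidef

theorem Positive.mono {E : MatMap n} (hE : Positive E) {A B : Mat n} (h : A ≤ B) : E A ≤ E B := by
  rw [Matrix.le_iff, ← map_sub]
  exact hE _ h

/-- With `B = Cᴴ C`, the form of `(E* B)ᴴ` at `w` is the trace of `C E(w wᴴ) Cᴴ`. The conjugate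
transpose is treated first because it is what the defining identity of the adjoint contains. -/
theorem Positive.adjointMap {E : MatMap n} (hE : Positive E) : Positive (adjointMap E) := by
  intro B hB
  rw [← Matrix.posSemidef_conjTranspose_iff]
  refine posSemidef_of_forall_nonneg fun w => ?_
  have hw := Matrix.posSemidef_vecMulVec_self_star w
  have h1 := trace_adjointMap E (Matrix.vecMulVec w (star w)) B
  obtain ⟨C, rfl⟩ := exists_eq_conjTranspose_mul_self hB
  have h2 : star w ⬝ᵥ ((OperatorSinkhorn.adjointMap E (Cᴴ * C))ᴴ *ᵥ w) =
      ((OperatorSinkhorn.adjointMap E (Cᴴ * C))ᴴ * Matrix.vecMulVec w (star w)).trace := by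
    rw [Matrix.mul_vecMulVec, Matrix.trace_vecMulVec, dotProduct_comm]
  rw [h2, h1, hB.1.eq, Matrix.mul_assoc, Matrix.trace_mul_comm]
  exact ((hE _ hw).mul_mul_conjTranspose_same C).trace_nonneg

theorem pair_adjointMap {E : MatMap n} (hE : Positive E) {f : Mat n} (hf : f.PosSemidef)
    (X : Mat n) : pair (adjointMap E f) X = pair f (E X) := by
  have h := trace_adjointMap E X f
  rw [(hE.adjointMap f hf).1.eq, hf.1.eq] at h
  rw [pair, pair, h]

theorem posDef_of_pair_pos {X : Mat n} (hX : X.PosSemidef)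
    (h : ∀ f : Mat n, f.PosSemidef → f ≠ 0 → 0 < pair f X) : X.PosDef := by
  refine Matrix.PosDef.of_dotProduct_mulVec_pos hX.1 fun w hw => ?_
  have h1 := h _ (Matrix.posSemidef_vecMulVec_self_star w) (by simpa using hw)
  rw [pair_vecMulVec] at h1
  exact Complex.lt_def.2 ⟨h1, (hX.1.im_star_dotProduct_mulVec_self w).symm⟩

theorem PositivityImproving.adjointMap {E : MatMap n} (hE : PositivityImproving E) :
    PositivityImproving (adjointMap E) := by
  intro B hB hB0
  refine posDef_of_pair_pos (hE.positive.adjointMap B hB) fun f hf hf0 => ?_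
  rw [pair_comm, pair_adjointMap hE.positive hB]
  exact pair_pos hB hB0 (hE f hf hf0)

end OperatorSinkhorn

/-! ### Hilbert's metric through two-sided order bounds -/

namespace OperatorSinkhorn

variable {n : ℕ}

/-- `a y ≤ x ≤ a eᵗ y` for some `a > 0`: the points `x`, `y` of the positive semidefinite cone are
at distance at most `t` in Hilbert's projective metric. -/
def HilbertBound (t : ℝ) (x y : Mat n) : Prop :=
  ∃ a : ℝ, 0 < a ∧ a • y ≤ x ∧ x ≤ (a * Real.exp t) • y

theorem pair_le_pair {f X Y : Mat n} (hf : f.PosSemidef) (h : X ≤ Y) : pair f X ≤ pair f Y := by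
  have := pair_nonneg hf (Matrix.le_iff.1 h)
  rw [pair_sub] at this
  linarith

theorem le_of_pair_le_pair {X Y : Mat n} (hX : X.IsHermitian) (hY : Y.IsHermitian)
    (h : ∀ f : Mat n, f.PosSemidef → pair f X ≤ pair f Y) : X ≤ Y := by
  rw [Matrix.le_iff]
  refine posSemidef_of_pair (hY.sub hX) fun f hf => ?_
  rw [pair_sub]
  linarith [h f hf]

theorem isHermitian_real_smul {X : Mat n} (hX : X.IsHermitian) (a : ℝ) : (a • X).IsHermitian := by
  rw [Matrix.IsHermitian, Matrix.conjTranspose_smul, hX.eq, star_trivial]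

theorem real_smul_le_smul {y : Mat n} (hy : y.PosSemidef) {a b : ℝ} (h : a ≤ b) :
    a • y ≤ b • y := by
  rw [Matrix.le_iff, ← sub_smul]
  exact hy.smul (sub_nonneg.2 h)

theorem le_of_real_smul_le_smul {y : Mat n} (hy : y.PosSemidef) (hy0 : y ≠ 0) {a b : ℝ}
    (h : a • y ≤ b • y) : a ≤ b := by
  have h1 := pair_le_pair Matrix.PosSemidef.one h
  have h2 : 0 < pair 1 y := by
    rw [pair_comm]; exact pair_pos hy hy0 Matrix.PosDef.one
  rw [pair_smul, pair_smul] at h1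
  exact le_of_mul_le_mul_right h1 h2

theorem real_smul_le_real_smul_of_le {x y : Mat n} (h : x ≤ y) {a : ℝ} (ha : 0 ≤ a) :
    a • x ≤ a • y := by
  rw [Matrix.le_iff, ← smul_sub]
  exact (Matrix.le_iff.1 h).smul ha

theorem map_real_smul (E : MatMap n) (a : ℝ) (x : Mat n) : E (a • x) = a • E x := by
  rw [← Complex.coe_smul, map_smul, Complex.coe_smul]

theorem conj_mono (X : Mat n) {x y : Mat n} (h : x ≤ y) : X * x * Xᴴ ≤ X * y * Xᴴ := by
  rw [Matrix.le_iff, ← Matrix.sub_mul, ← Matrix.mul_sub]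
  exact (Matrix.le_iff.1 h).mul_mul_conjTranspose_same X

namespace HilbertBound

theorem mono {s t : ℝ} {x y : Mat n} (h : HilbertBound s x y) (hy : y.PosSemidef) (hst : s ≤ t) :
    HilbertBound t x y := by
  obtain ⟨a, ha, h1, h2⟩ := h
  refine ⟨a, ha, h1, h2.trans (real_smul_le_smul hy ?_)⟩
  have := Real.exp_le_exp.2 hst
  gcongr

theorem map {t : ℝ} {x y : Mat n} (h : HilbertBound t x y) {E : MatMap n} (hE : Positive E) :
    HilbertBound t (E x) (E y) := by
  obtain ⟨a, ha, h1, h2⟩ := h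
  refine ⟨a, ha, ?_, ?_⟩
  · simpa only [map_real_smul] using hE.mono h1
  · simpa only [map_real_smul] using hE.mono h2

theorem conj {t : ℝ} {x y : Mat n} (h : HilbertBound t x y) (X : Mat n) :
    HilbertBound t (X * x * Xᴴ) (X * y * Xᴴ) := by
  obtain ⟨a, ha, h1, h2⟩ := h
  refine ⟨a, ha, ?_, ?_⟩
  · simpa using conj_mono X h1
  · simpa using conj_mono X h2

theorem trans {s t : ℝ} {x y z : Mat n} (h : HilbertBound s x y) (h' : HilbertBound t y z) :
    HilbertBound (s + t) x z := by
  obtain ⟨a, ha, h1, h2⟩ := h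
  obtain ⟨b, hb, h3, h4⟩ := h'
  refine ⟨a * b, mul_pos ha hb, ?_, ?_⟩
  · rw [mul_smul]
    exact (real_smul_le_real_smul_of_le h3 ha.le).trans h1
  · have e : a * b * Real.exp (s + t) = (a * Real.exp s) * (b * Real.exp t) := by
      rw [Real.exp_add]; ring
    rw [e, mul_smul]
    exact h2.trans (real_smul_le_real_smul_of_le h4 (by positivity))

theorem symm {t : ℝ} {x y : Mat n} (h : HilbertBound t x y) : HilbertBound t y x := by
  obtain ⟨a, ha, h1, h2⟩ := h
  have hb : 0 < a * Real.exp t := by positivity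
  refine ⟨(a * Real.exp t)⁻¹, inv_pos.2 hb, ?_, ?_⟩
  · have := real_smul_le_real_smul_of_le h2 (inv_pos.2 hb).le
    rwa [smul_smul, inv_mul_cancel₀ hb.ne', one_smul] at this
  · have := real_smul_le_real_smul_of_le h1 (inv_pos.2 ha).le
    rw [smul_smul, inv_mul_cancel₀ ha.ne', one_smul] at this
    convert this using 2
    field_simp

theorem of_smul {a : ℝ} (ha : 0 < a) (y : Mat n) : HilbertBound 0 (a • y) y :=
  ⟨a, ha, le_rfl, by simp⟩

theorem eq_smul {x y : Mat n} (h : HilbertBound 0 x y) : ∃ a : ℝ, 0 < a ∧ x = a • y := by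
  obtain ⟨a, ha, h1, h2⟩ := h
  rw [Real.exp_zero, mul_one] at h2
  exact ⟨a, ha, le_antisymm h2 h1⟩

theorem nonneg {t : ℝ} {x y : Mat n} (h : HilbertBound t x y) (hy : y.PosSemidef) (hy0 : y ≠ 0) :
    0 ≤ t := by
  obtain ⟨a, ha, h1, h2⟩ := h
  have := le_of_real_smul_le_smul hy hy0 (h1.trans h2)
  have h3 : 1 ≤ Real.exp t := by
    by_contra hc
    nlinarith
  exact Real.one_le_exp_iff.1 h3

theorem comparable {t : ℝ} {x y : Mat n} (h : HilbertBound t x y) (hx : x.PosSemidef)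
    (hy : y.PosSemidef) : Comparable x y := by
  obtain ⟨a, ha, h1, h2⟩ := h
  refine ⟨hx, hy, ⟨_, by positivity, Matrix.le_iff.1 h2⟩, a⁻¹, inv_pos.2 ha, ?_⟩
  have := real_smul_le_real_smul_of_le h1 (inv_pos.2 ha).le
  rwa [smul_smul, inv_mul_cancel₀ ha.ne', one_smul, Matrix.le_iff] at this

theorem hilbertSup_le {x y : Mat n} {b : ℝ} (hb : 0 < b) (h : x ≤ b • y) : hilbertSup x y ≤ b :=
  csInf_le ⟨0, fun _ h => h.1.le⟩ ⟨hb, Matrix.le_iff.1 h⟩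

theorem le_hilbertSup {x y : Mat n} (hy : y.PosSemidef) (hy0 : y ≠ 0) {a b : ℝ} (hb : 0 < b)
    (h1 : a • y ≤ x) (h : x ≤ b • y) : a ≤ hilbertSup x y :=
  le_csInf ⟨b, hb, Matrix.le_iff.1 h⟩ fun _ hc =>
    le_of_real_smul_le_smul hy hy0 (h1.trans (Matrix.le_iff.2 hc.2))

theorem le_hilbertInf {x y : Mat n} (hy : y.PosSemidef) (hy0 : y ≠ 0) {a b : ℝ} (ha : 0 < a)
    (h1 : a • y ≤ x) (h : x ≤ b • y) : a ≤ hilbertInf x y :=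
  le_csSup ⟨b, fun _ hc => le_of_real_smul_le_smul hy hy0 ((Matrix.le_iff.2 hc.2).trans h)⟩
    ⟨ha, Matrix.le_iff.1 h1⟩

theorem dH_le {t : ℝ} {x y : Mat n} (h : HilbertBound t x y) (hx : x.PosSemidef)
    (hy : y.PosSemidef) : dH x y ≤ ENNReal.ofReal t := by
  by_cases hy0 : y = 0
  · obtain ⟨a, ha, h1, h2⟩ := h
    subst hy0
    have : x = 0 := le_antisymm (by simpa using h2) (by simpa using h1)
    simp [dH, this]
  have hc := h.comparable hx hy
  obtain ⟨a, ha, h1, h2⟩ := h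
  rw [dH, if_neg (fun hh => hy0 hh.2), if_pos hc]
  refine ENNReal.ofReal_le_ofReal ?_
  have hb : 0 < a * Real.exp t := by positivity
  have i1 := hilbertSup_le hb h2
  have i2 := le_hilbertSup hy hy0 hb h1 h2
  have i3 := le_hilbertInf hy hy0 ha h1 h2
  rw [Real.log_le_iff_le_exp (div_pos (ha.trans_le i2) (ha.trans_le i3)),
    div_le_iff₀ (ha.trans_le i3)]
  nlinarith [Real.exp_pos t]

end HilbertBound

/-- The infimum is attained: against each positive functional the inequality is a closed scalar
condition. Where the functional kills `y`, comparability makes it kill `x` too. -/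
theorem Comparable.le_hilbertSup_smul {x y : Mat n} (h : Comparable x y) :
    x ≤ hilbertSup x y • y := by
  obtain ⟨hx, hy, ⟨b, hb, h2⟩, -⟩ := h
  refine le_of_pair_le_pair hx.1 (isHermitian_real_smul hy.1 _) fun f hf => ?_
  rw [pair_smul]
  rcases (pair_nonneg hf hy).eq_or_lt with h0 | h0
  · have := pair_le_pair hf (Matrix.le_iff.2 h2)
    rw [pair_smul] at this
    rw [← h0] at this ⊢
    simpa using this
  · rw [← div_le_iff₀ h0]
    refine le_csInf ⟨b, hb, h2⟩ fun c hc => ?_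
    rw [div_le_iff₀ h0, ← pair_smul]
    exact pair_le_pair hf (Matrix.le_iff.2 hc.2)

theorem Comparable.hilbertInf_smul_le {x y : Mat n} (h : Comparable x y) :
    hilbertInf x y • y ≤ x := by
  obtain ⟨hx, hy, -, b, hb, h2⟩ := h
  have hne : b⁻¹ ∈ {α : ℝ | 0 < α ∧ (x - α • y).PosSemidef} := by
    refine ⟨inv_pos.2 hb, ?_⟩
    have := real_smul_le_real_smul_of_le (Matrix.le_iff.2 h2) (inv_pos.2 hb).le
    rwa [smul_smul, inv_mul_cancel₀ hb.ne', one_smul, Matrix.le_iff] at this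
  refine le_of_pair_le_pair (isHermitian_real_smul hy.1 _) hx.1 fun f hf => ?_
  rw [pair_smul]
  rcases (pair_nonneg hf hy).eq_or_lt with h0 | h0
  · rw [← h0, mul_zero]
    exact pair_nonneg hf hx
  · rw [← le_div_iff₀ h0]
    refine csSup_le ⟨_, hne⟩ fun c hc => ?_
    rw [le_div_iff₀ h0, ← pair_smul]
    exact pair_le_pair hf (Matrix.le_iff.2 hc.2)

/-- `d_H(x, y) ≤ t` is attained. -/
theorem hilbertBound_of_dH_le {t : ℝ} {x y : Mat n} (hxy : ¬(x = 0 ∧ y = 0)) (ht : 0 ≤ t)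
    (h : dH x y ≤ ENNReal.ofReal t) : HilbertBound t x y := by
  rw [dH, if_neg hxy] at h
  by_cases hc : Comparable x y
  · rw [if_pos hc, ENNReal.ofReal_le_ofReal_iff ht] at h
    have u1 := hc.le_hilbertSup_smul
    have u2 := hc.hilbertInf_smul_le
    obtain ⟨hx, hy, ⟨b, hb, h2⟩, c, hc0, h3⟩ := hc
    have hy0 : y ≠ 0 := by
      rintro rfl
      refine hxy ⟨le_antisymm ?_ hx.nonneg, rfl⟩
      simpa using Matrix.le_iff.2 h2
    have h4 : c⁻¹ • y ≤ x := by
      have := real_smul_le_real_smul_of_le (Matrix.le_iff.2 h3) (inv_pos.2 hc0).le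
      rwa [smul_smul, inv_mul_cancel₀ hc0.ne', one_smul] at this
    have hI := HilbertBound.le_hilbertInf hy hy0 (inv_pos.2 hc0) h4 (Matrix.le_iff.2 h2)
    have hS := HilbertBound.le_hilbertSup hy hy0 hb h4 (Matrix.le_iff.2 h2)
    have hI0 := (inv_pos.2 hc0).trans_le hI
    have hS0 := (inv_pos.2 hc0).trans_le hS
    refine ⟨_, hI0, u2, u1.trans (real_smul_le_smul hy ?_)⟩
    rwa [Real.log_le_iff_le_exp (div_pos hS0 hI0), div_le_iff₀ hI0, mul_comm] at h
  · rw [if_neg hc] at h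
    exact absurd h (by simp)

/-- Bounded cross ratios of two positive definite matrices give two-sided bounds. -/
theorem exists_smul_le_of_cross [NeZero n] {p q : Mat n} (hp : p.PosDef) (hq : q.PosDef) {K : ℝ}
    (h : ∀ f g : Mat n, f.PosSemidef → g.PosSemidef →
      pair f p * pair g q ≤ K * (pair f q * pair g p)) :
    ∃ r : ℝ, 0 < r ∧ r • q ≤ p ∧ p ≤ (r * K) • q := by
  have h11 : 0 < pair 1 p := pair_pos Matrix.PosSemidef.one one_ne_zero hp
  have h12 : 0 < pair 1 q := pair_pos Matrix.PosSemidef.one one_ne_zero hq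
  have hK : 0 < K := by
    have := h 1 1 Matrix.PosSemidef.one Matrix.PosSemidef.one
    by_contra hc
    nlinarith [mul_pos h11 h12, mul_comm (pair 1 p) (pair 1 q)]
  -- The infimum of the ratios is the largest `r` with `r q ≤ p`; the cross bound keeps every ratio
  -- below `K` times it.
  set S : Set ℝ := {s | ∃ g : Mat n, g.PosSemidef ∧ g ≠ 0 ∧ s = pair g p / pair g q} with hS
  have hSne : S.Nonempty := ⟨_, 1, Matrix.PosSemidef.one, one_ne_zero, rfl⟩
  have hlow : ∀ f : Mat n, f.PosSemidef → f ≠ 0 → pair f p / (K * pair f q) ≤ sInf S := by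
    intro f hf hf0
    refine le_csInf hSne ?_
    rintro s ⟨g, hg, hg0, rfl⟩
    have := h f g hf hg
    have a1 := pair_pos hf hf0 hq
    have a2 := pair_pos hg hg0 hq
    rw [div_le_div_iff₀ (by positivity) a2]
    linarith
  have hr : 0 < sInf S :=
    (div_pos h11 (mul_pos hK h12)).trans_le (hlow 1 Matrix.PosSemidef.one one_ne_zero)
  refine ⟨sInf S, hr, ?_, ?_⟩
  · refine le_of_pair_le_pair (isHermitian_real_smul hq.1 _) hp.1 fun f hf => ?_
    by_cases hf0 : f = 0
    · simp [hf0, pair]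
    have a1 := pair_pos hf hf0 hq
    rw [pair_smul, ← le_div_iff₀ a1]
    refine csInf_le ⟨0, ?_⟩ ⟨f, hf, hf0, rfl⟩
    rintro s ⟨g, hg, hg0, rfl⟩
    exact div_nonneg (pair_nonneg hg hp.posSemidef) (pair_nonneg hg hq.posSemidef)
  · refine le_of_pair_le_pair hp.1 (isHermitian_real_smul hq.1 _) fun f hf => ?_
    by_cases hf0 : f = 0
    · simp [hf0, pair]
    have a1 := pair_pos hf hf0 hq
    have := hlow f hf hf0
    rw [div_le_iff₀ (by positivity)] at this
    rw [pair_smul]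
    linarith

theorem HilbertBound.cross {t : ℝ} {p q : Mat n} (h : HilbertBound t p q) (hq : q.PosSemidef)
    {f g : Mat n} (hf : f.PosSemidef) (hg : g.PosSemidef) :
    pair f p * pair g q ≤ Real.exp t * (pair f q * pair g p) := by
  obtain ⟨a, ha, h1, h2⟩ := h
  have i1 := pair_le_pair hg h1
  have i2 := pair_le_pair hf h2
  rw [pair_smul] at i1 i2
  have i3 := pair_nonneg hf hq
  have i4 := pair_nonneg hg hq
  calc pair f p * pair g q ≤ (a * Real.exp t * pair f q) * pair g q := by gcongr
    _ = Real.exp t * (pair f q * (a * pair g q)) := by ring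
    _ ≤ Real.exp t * (pair f q * pair g p) := by gcongr

theorem hilbertBound_of_cross [NeZero n] {t : ℝ} {p q : Mat n} (hp : p.PosDef) (hq : q.PosDef)
    (h : ∀ f g : Mat n, f.PosSemidef → g.PosSemidef →
      pair f p * pair g q ≤ Real.exp t * (pair f q * pair g p)) : HilbertBound t p q :=
  exists_smul_le_of_cross hp hq h

section Norm

open scoped Matrix.Norms.L2Operator

/-- The spectrum of `p` lies in some `[r, ‖p‖]` with `r > 0`. -/
theorem exists_hilbertBound_one [NeZero n] {p : Mat n} (hp : p.PosDef) :
    ∃ t : ℝ, 0 ≤ t ∧ HilbertBound t p 1 := by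
  have hsa : IsSelfAdjoint p := hp.1
  have h1 := hsa.le_algebraMap_norm_self
  obtain ⟨r, hr, h2⟩ := (CFC.exists_pos_algebraMap_le_iff (A := Mat n) hsa).2
    fun x hx => hp.isStrictlyPositive.spectrum_pos hx
  rw [Algebra.algebraMap_eq_smul_one] at h1 h2
  have hle := le_of_real_smul_le_smul Matrix.PosSemidef.one one_ne_zero (h2.trans h1)
  have hb : HilbertBound (Real.log (‖p‖ / r)) p 1 := by
    refine ⟨r, hr, h2, ?_⟩
    rwa [Real.exp_log (div_pos (hr.trans_le hle) hr), mul_div_cancel₀ _ hr.ne']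
  exact ⟨_, hb.nonneg Matrix.PosSemidef.one one_ne_zero, hb⟩

end Norm

end OperatorSinkhorn

/-! ### Cross ratios and Birkhoff-Hopf contraction -/

namespace OperatorSinkhorn

variable {n : ℕ}

/-- The cross ratios of `F` are at most `K`. -/
def CrossRatioBound (K : ℝ) (F : MatMap n) : Prop :=
  ∀ f g u v : Mat n, f.PosSemidef → g.PosSemidef → u.PosSemidef → v.PosSemidef →
    pair f (F u) * pair g (F v) ≤ K * (pair f (F v) * pair g (F u))

/-- `F` contracts Hilbert's metric by the factor `c`. -/
def Contracts (c : ℝ) (F : MatMap n) : Prop :=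
  ∀ (t : ℝ) (x y : Mat n), x.PosSemidef → y.PosSemidef → 0 ≤ t → HilbertBound t x y →
    HilbertBound (c * t) (F x) (F y)

/-- Passing to the adjoint exchanges test functionals and points, and the cross ratio is symmetric
under this exchange. -/
theorem CrossRatioBound.adjointMap {K : ℝ} {F : MatMap n} (h : CrossRatioBound K F)
    (hF : Positive F) : CrossRatioBound K (adjointMap F) := by
  intro f g u v hf hg hu hv
  have := h u v f g hu hv hf hg
  simp only [pair_comm f, pair_comm g, pair_adjointMap hF hu, pair_adjointMap hF hv]
  linarith

theorem pair_scaling (E : MatMap n) (X Y f A : Mat n) :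
    pair f (scaling E X Y A) = pair (Yᴴ * f * Y) (E (X * A * Xᴴ)) := by
  have h : f * (Y * E (X * A * Xᴴ) * Yᴴ) = (f * Y * E (X * A * Xᴴ)) * Yᴴ := by
    simp only [Matrix.mul_assoc]
  rw [pair, pair, scaling, LinearMap.coe_mk, AddHom.coe_mk, h, Matrix.trace_mul_comm]
  simp only [Matrix.mul_assoc]

theorem CrossRatioBound.scaling {K : ℝ} {F : MatMap n} (h : CrossRatioBound K F) (X Y : Mat n) :
    CrossRatioBound K (scaling F X Y) := by
  intro f g u v hf hg hu hv
  simp only [pair_scaling]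
  exact h _ _ _ _ (hf.conjTranspose_mul_mul_same Y) (hg.conjTranspose_mul_mul_same Y)
    (hu.mul_mul_conjTranspose_same X) (hv.mul_mul_conjTranspose_same X)

/-- The two-dimensional case of the Birkhoff-Hopf theorem. -/
theorem birkhoff_two_dim {k m s : ℝ} (hk : 1 ≤ k) (hm : 0 < m) (hs : 0 ≤ s) :
    (Real.exp s * (m * k ^ 2) + 1) / (m * k ^ 2 + 1) ≤
      (Real.exp s * m + 1) / (m + 1) * Real.exp ((k - 1) / (k + 1) * s) := by
  set f : ℝ → ℝ := fun s => (k - 1) / (k + 1) * s - Real.log (Real.exp s * (m * k ^ 2) + 1) +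
    Real.log (Real.exp s * m + 1) with hf
  have hk0 : 0 < k := by linarith
  have hd : ∀ s, HasDerivAt f ((k - 1) / (k + 1) -
      (Real.exp s * (m * k ^ 2)) / (Real.exp s * (m * k ^ 2) + 1) +
      (Real.exp s * m) / (Real.exp s * m + 1)) s := by
    intro s
    have e := Real.hasDerivAt_exp s
    have p1 : Real.exp s * (m * k ^ 2) + 1 ≠ 0 := by positivity
    have p2 : Real.exp s * m + 1 ≠ 0 := by positivity
    have d1 := ((e.mul_const (m * k ^ 2)).add_const 1).log p1
    have d2 := ((e.mul_const m).add_const 1).log p2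
    have d0 : HasDerivAt (fun s : ℝ => (k - 1) / (k + 1) * s) ((k - 1) / (k + 1)) s := by
      simpa using (hasDerivAt_id s).const_mul ((k - 1) / (k + 1))
    exact (d0.sub d1).add d2
  have hmono : Monotone f := by
    refine monotone_of_deriv_nonneg (fun s => (hd s).differentiableAt) fun s => ?_
    rw [(hd s).deriv]
    have hz : 0 < Real.exp s * m := by positivity
    generalize hzz : Real.exp s * m = z at hz
    rw [← mul_assoc, hzz]
    -- The difference of the two logistic terms is largest at `z = 1 / k`, with value exactly `(k -
    -- 1) / (k + 1)`; hence the perfect square.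
    have : (k - 1) / (k + 1) - z * k ^ 2 / (z * k ^ 2 + 1) + z / (z + 1) =
        (k - 1) * (k * z - 1) ^ 2 / ((k + 1) * (z * k ^ 2 + 1) * (z + 1)) := by
      field_simp
      ring
    rw [this]
    have : 0 ≤ k - 1 := by linarith
    positivity
  have h0 := hmono hs
  simp only [hf, Real.exp_zero, one_mul, mul_zero] at h0
  have q1 : 0 < Real.exp s * (m * k ^ 2) + 1 := by positivity
  have q2 : 0 < Real.exp s * m + 1 := by positivity
  have q3 : 0 < m * k ^ 2 + 1 := by positivity
  have q4 : 0 < m + 1 := by positivity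
  rw [← Real.log_le_log_iff (by positivity) (by positivity), Real.log_mul (by positivity)
    (by positivity), Real.log_div q1.ne' q3.ne', Real.log_div q2.ne' q4.ne', Real.log_exp]
  linarith

/-- Hopf's bound on the contraction ratio in terms of cross ratios. -/
theorem CrossRatioBound.contracts [NeZero n] {k : ℝ} (hk : 1 ≤ k) {F : MatMap n}
    (h : CrossRatioBound (k ^ 2) F) (hF : PositivityImproving F) :
    Contracts ((k - 1) / (k + 1)) F := by
  intro t x y hx hy ht hxy
  have hct : 0 ≤ (k - 1) / (k + 1) * t :=
    mul_nonneg (div_nonneg (by linarith) (by linarith)) ht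
  have hFy := hF.positive y hy
  obtain ⟨a, ha, h1, h2⟩ := hxy
  rcases ht.eq_or_lt with rfl | ht0
  · rw [mul_zero]
    exact HilbertBound.map ⟨a, ha, h1, h2⟩ hF.positive
  -- Up to positive scalars, `x` is `eᵗ u + v` and `y` is `u + v`, which reduces the estimate to the
  -- plane spanned by `u` and `v`.
  set u : Mat n := x - a • y with hu
  set v : Mat n := (a * Real.exp t) • y - x with hv
  have hup : u.PosSemidef := Matrix.le_iff.1 h1
  have hvp : v.PosSemidef := Matrix.le_iff.1 h2
  by_cases hu0 : u = 0
  · have hxa : x = a • y := sub_eq_zero.1 (hu ▸ hu0)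
    rw [hxa, map_real_smul]
    exact (HilbertBound.of_smul ha _).mono hFy hct
  by_cases hv0 : v = 0
  · have hxa : x = (a * Real.exp t) • y := (sub_eq_zero.1 (hv ▸ hv0)).symm
    rw [hxa, map_real_smul]
    exact (HilbertBound.of_smul (by positivity) _).mono hFy hct
  have hp := hF u hup hu0
  have hq := hF v hvp hv0
  obtain ⟨r, hr, r1, r2⟩ := exists_smul_le_of_cross hp hq
    fun f g hf hg => h f g u v hf hg hup hvp
  have key : HilbertBound ((k - 1) / (k + 1) * t) (Real.exp t • F u + F v) (F u + F v) := by
    have e1 : 0 ≤ Real.exp t - 1 := by linarith [Real.add_one_le_exp t]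
    -- The ratio `(eᵗ s + 1) / (s + 1)` increases with `s`. Since `F u` lies between `r F v` and `r
    -- k² F v`, the values at `s = r` and `s = r k²` are the bounds, compared by `birkhoff_two_dim`.
    refine ⟨(Real.exp t * r + 1) / (r + 1), by positivity, ?_, ?_⟩
    · rw [Matrix.le_iff]
      have e : Real.exp t • F u + F v - ((Real.exp t * r + 1) / (r + 1)) • (F u + F v) =
          ((Real.exp t - 1) / (r + 1)) • (F u - r • F v) := by
        have e2 : (Real.exp t * r + 1) / (r + 1) = 1 + r * ((Real.exp t - 1) / (r + 1)) := by
          field_simp; ring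
        have e3 : Real.exp t = 1 + (r + 1) * ((Real.exp t - 1) / (r + 1)) := by
          field_simp; ring
        rw [e2]
        nth_rewrite 1 [e3]
        module
      rw [e]
      exact (Matrix.le_iff.1 r1).smul (div_nonneg e1 (by linarith))
    · refine le_trans ?_ (real_smul_le_smul (hp.posSemidef.add hq.posSemidef)
        (birkhoff_two_dim hk hr ht))
      rw [Matrix.le_iff]
      have hR : 0 < r * k ^ 2 + 1 := by positivity
      set R := r * k ^ 2
      have e : ((Real.exp t * R + 1) / (R + 1)) • (F u + F v) - (Real.exp t • F u + F v) =
          ((Real.exp t - 1) / (R + 1)) • (R • F v - F u) := by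
        have e2 : (Real.exp t * R + 1) / (R + 1) = 1 + R * ((Real.exp t - 1) / (R + 1)) := by
          field_simp; ring
        have e3 : Real.exp t = 1 + (R + 1) * ((Real.exp t - 1) / (R + 1)) := by
          field_simp; ring
        rw [e2]
        nth_rewrite 2 [e3]
        module
      rw [e]
      exact (Matrix.le_iff.1 r2).smul (div_nonneg e1 hR.le)
  have hs : 0 < Real.exp t - 1 := by linarith [Real.add_one_lt_exp ht0.ne']
  have ey : F u + F v = (a * (Real.exp t - 1)) • F y := by
    rw [← map_add, ← map_real_smul]
    congr 1
    rw [hu, hv]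
    module
  have ex : Real.exp t • F u + F v = (Real.exp t - 1) • F x := by
    rw [← map_real_smul, ← map_add, ← map_real_smul]
    congr 1
    rw [hu, hv]
    module
  rw [ex, ey] at key
  have k1 := (HilbertBound.of_smul hs (F x)).symm.trans key
  have k2 := k1.trans (HilbertBound.of_smul (mul_pos ha hs) (F y))
  simpa using k2

theorem deriv_nonneg_of_nonneg_right {h : ℝ → ℝ} {d : ℝ} (hd : HasDerivAt h d 0) (h0 : h 0 = 0)
    (hn : ∀ t, 0 ≤ t → 0 ≤ h t) : 0 ≤ d := by
  refine ge_of_tendsto hd.tendsto_slope_zero_right ?_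
  filter_upwards [self_mem_nhdsWithin] with t ht
  have ht' : 0 < t := ht
  simp only [zero_add, h0, sub_zero, smul_eq_mul]
  exact mul_nonneg (inv_pos.2 ht').le (hn t ht'.le)

/-- Cross ratios are bounded in terms of a contraction factor. -/
theorem Contracts.crossRatioBound {c : ℝ} (hc1 : c < 1) {F : MatMap n}
    (h : Contracts c F) (hF : PositivityImproving F) :
    CrossRatioBound (((1 + c) / (1 - c)) ^ 2) F := by
  intro f g u v hf hg hu hv
  by_cases hf0 : f = 0
  · simp [hf0, pair]
  by_cases hg0 : g = 0
  · simp [hg0, pair]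
  by_cases hu0 : u = 0
  · simp [hu0, pair]
  by_cases hv0 : v = 0
  · simp [hv0, pair]
  have hA := pair_pos hf hf0 (hF u hu hu0)
  have hB := pair_pos hf hf0 (hF v hv hv0)
  have hC := pair_pos hg hg0 (hF u hu hu0)
  have hD := pair_pos hg hg0 (hF v hv hv0)
  -- Infinitesimal form of the contraction: `eᵗ l u + v` is within `t` of `l u + v`, and the cross
  -- inequality for the images is an equality at `t = 0`, so it may be differentiated there.
  have key : ∀ l : ℝ, 0 < l → l * (pair f (F u) * pair g (F v) - pair f (F v) * pair g (F u)) ≤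
      c * ((l * pair f (F u) + pair f (F v)) * (l * pair g (F u) + pair g (F v))) := by
    intro l hl
    have hlu : (l • u).PosSemidef := hu.smul hl.le
    set A := pair f (F u)
    set B := pair f (F v)
    set C := pair g (F u)
    set D := pair g (F v)
    have hn : ∀ t : ℝ, 0 ≤ t → 0 ≤ Real.exp (c * t) * ((l * A + B) * (Real.exp t * (l * C) + D)) -
        (Real.exp t * (l * A) + B) * (l * C + D) := by
      intro t ht
      have e1 := Real.one_le_exp ht
      have hxp : (Real.exp t • (l • u) + v).PosSemidef :=
        (hlu.smul (Real.exp_pos t).le).add hv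
      have hb : HilbertBound t (Real.exp t • (l • u) + v) (l • u + v) := by
        refine ⟨1, one_pos, ?_, ?_⟩
        · rw [Matrix.le_iff]
          have e : Real.exp t • (l • u) + v - (1 : ℝ) • (l • u + v) =
            (Real.exp t - 1) • (l • u) := by module
          rw [e]
          exact hlu.smul (sub_nonneg.2 e1)
        · rw [Matrix.le_iff]
          have e : (1 * Real.exp t) • (l • u + v) - (Real.exp t • (l • u) + v) =
            (Real.exp t - 1) • v := by module
          rw [e]
          exact hv.smul (sub_nonneg.2 e1)
      have := (h t _ _ hxp (hlu.add hv) ht hb).cross (hF.positive _ (hlu.add hv)) hf hg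
      simp only [map_add, map_real_smul, pair_add, pair_smul] at this
      linarith
    have hd : HasDerivAt (fun t : ℝ => Real.exp (c * t) *
        ((l * A + B) * (Real.exp t * (l * C) + D)) - (Real.exp t * (l * A) + B) * (l * C + D))
        (c * ((l * A + B) * (l * C + D)) + (l * A + B) * (l * C) - l * A * (l * C + D)) 0 := by
      have e := Real.hasDerivAt_exp 0
      have e2 : HasDerivAt (fun t : ℝ => Real.exp (c * t)) c 0 := by
        have := ((hasDerivAt_id (0 : ℝ)).const_mul c).exp
        simpa using this
      have d1 := e2.mul (((e.mul_const (l * C)).add_const D).const_mul (l * A + B))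
      have d2 := ((e.mul_const (l * A)).add_const B).mul_const (l * C + D)
      refine (d1.sub d2).congr_deriv ?_
      simp only [mul_zero, Real.exp_zero]
      ring
    have := deriv_nonneg_of_nonneg_right hd (by simp) hn
    linarith
  generalize pair f (F u) = A at *
  generalize pair f (F v) = B at *
  generalize pair g (F u) = C at *
  generalize pair g (F v) = D at *
  obtain ⟨x, hx, hx2⟩ : ∃ x : ℝ, 0 < x ∧ x ^ 2 = A * D :=
    ⟨√(A * D), by positivity, Real.sq_sqrt (by positivity)⟩
  obtain ⟨y, hy, hy2⟩ : ∃ y : ℝ, 0 < y ∧ y ^ 2 = B * C :=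
    ⟨√(B * C), by positivity, Real.sq_sqrt (by positivity)⟩
  -- This `l` equals `√(BD / (AC))`, the minimizer of `(lA + B)(lC + D) / l`, with minimum `(x +
  -- y)²`.
  have hk := key (x * y / (A * C)) (by positivity)
  have e1 : (x * y / (A * C) * A + B) * (x * y / (A * C) * C + D) =
      x * y / (A * C) * (x + y) ^ 2 := by
    have : x * y / (A * C) * (x + y) ^ 2 =
      x * y / (A * C) * (A * D + B * C) + 2 * (A * D * (B * C)) / (A * C) := by
      rw [← hx2, ← hy2]; field_simp; ring
    rw [this]
    have h3 : (x * y / (A * C)) ^ 2 * (A * C) = B * D := by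
      have : (x * y) ^ 2 = A * D * (B * C) := by rw [mul_pow, hx2, hy2]
      rw [div_pow, this]; field_simp
    have h4 : 2 * (A * D * (B * C)) / (A * C) = 2 * (B * D) := by field_simp
    rw [h4]
    linear_combination h3
  rw [e1, mul_left_comm] at hk
  have hk2 := le_of_mul_le_mul_left hk (by positivity)
  rw [← hx2, ← hy2] at hk2 ⊢
  have h5 : (x - y) ≤ c * (x + y) := by
    have : (x + y) * (x - y) ≤ (x + y) * (c * (x + y)) := by linarith
    exact le_of_mul_le_mul_left this (by positivity)
  have h6 : x ≤ (1 + c) / (1 - c) * y := by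
    rw [div_mul_eq_mul_div, le_div_iff₀ (by linarith)]
    linarith
  rw [← mul_pow]
  gcongr

theorem Contracts.contractionRatio_le {c : ℝ} (hc : 0 ≤ c) {F : MatMap n} (h : Contracts c F)
    (hF : Positive F) : contractionRatio F ≤ ENNReal.ofReal c := by
  refine iSup_le fun x => iSup_le fun y => iSup_le fun hx => iSup_le fun hy => iSup_le fun h0 =>
    iSup_le fun h1 => ?_
  have hxy : ¬(x = 0 ∧ y = 0) := fun hh => h0 (by simp [dH, hh.1, hh.2])
  have hb := hilbertBound_of_dH_le hxy ENNReal.toReal_nonneg (ENNReal.ofReal_toReal h1).ge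
  have := (h _ x y hx hy ENNReal.toReal_nonneg hb).dH_le (hF x hx) (hF y hy)
  rw [ENNReal.ofReal_mul hc, ENNReal.ofReal_toReal h1] at this
  exact ENNReal.div_le_of_le_mul this

theorem contracts_of_contractionRatio_le {c : ℝ} (hc : 0 ≤ c) {F : MatMap n}
    (hF : PositivityImproving F) (h : contractionRatio F ≤ ENNReal.ofReal c) :
    Contracts c F := by
  intro t x y hx hy ht hb
  have hFy := hF.positive y hy
  by_cases hx0 : x = 0
  · refine ⟨1, one_pos, ?_⟩
    obtain ⟨a, ha, h1, h2⟩ := hb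
    have hy0 : y = 0 := by
      refine le_antisymm ?_ hy.nonneg
      have := real_smul_le_real_smul_of_le h1 (inv_pos.2 ha).le
      rwa [smul_smul, inv_mul_cancel₀ ha.ne', one_smul, hx0, smul_zero] at this
    simp [hx0, hy0]
  have hxy : ¬(x = 0 ∧ y = 0) := fun hh => hx0 hh.1
  have hd := hb.dH_le hx hy
  -- Pairs at distance zero are excluded from the supremum; they are proportional, so positivity
  -- alone handles them.
  by_cases hd0 : dH x y = 0
  · have h0 := (hilbertBound_of_dH_le hxy le_rfl (by simp [hd0])).map hF.positive
    exact h0.mono hFy (mul_nonneg hc ht)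
  have hdt : dH x y ≠ ⊤ := ne_top_of_le_ne_top ENNReal.ofReal_ne_top hd
  have h1 : dH (F x) (F y) / dH x y ≤ contractionRatio F :=
    le_iSup_of_le x <| le_iSup_of_le y <| le_iSup_of_le hx <| le_iSup_of_le hy <|
      le_iSup_of_le hd0 <| le_iSup_of_le hdt le_rfl
  have h2 := (ENNReal.div_le_iff hd0 hdt).1 (h1.trans h)
  refine hilbertBound_of_dH_le ?_ (mul_nonneg hc ht) ?_
  · intro hh
    by_cases hn : n = 0
    · subst hn
      exact hx0 (Subsingleton.elim _ _)
    · have : NeZero n := ⟨hn⟩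
      have := (hF x hx hx0).isUnit
      rw [hh.1] at this
      exact not_isUnit_zero this
  · rw [ENNReal.ofReal_mul hc]
    exact h2.trans (by gcongr)

section Norm

open scoped Matrix.Norms.L2Operator

/-- Every positive semidefinite matrix is a nonnegative multiple of `Bᴴ B` with `‖B‖ = 1`. On the
compact product of unit spheres the pairing is continuous and positive, so maximum over minimum
serves as `k`. -/
theorem PositivityImproving.exists_crossRatioBound [NeZero n] {F : MatMap n}
    (hF : PositivityImproving F) : ∃ k : ℝ, 1 ≤ k ∧ CrossRatioBound (k ^ 2) F := by
  set G : Mat n × Mat n → ℝ := fun p => pair (p.1ᴴ * p.1) (F (p.2ᴴ * p.2)) with hG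
  have hFc : Continuous F := F.continuous_of_finiteDimensional
  have hc : Continuous G := by
    simp only [hG, pair]
    fun_prop
  have hcomp : IsCompact (Metric.sphere (0 : Mat n) 1 ×ˢ Metric.sphere (0 : Mat n) 1) :=
    (isCompact_sphere _ _).prod (isCompact_sphere _ _)
  have hne : (Metric.sphere (0 : Mat n) 1 ×ˢ Metric.sphere (0 : Mat n) 1).Nonempty :=
    ⟨(1, 1), by simp⟩
  obtain ⟨p, hp, hmin⟩ := hcomp.exists_isMinOn hne hc.continuousOn
  obtain ⟨q, hq, hmax⟩ := hcomp.exists_isMaxOn hne hc.continuousOn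
  have hne0 : ∀ B : Mat n, B ∈ Metric.sphere (0 : Mat n) 1 → Bᴴ * B ≠ 0 := by
    intro B hB h0
    rw [Matrix.conjTranspose_mul_self_eq_zero] at h0
    simp [h0] at hB
  have hδ : 0 < G p := pair_pos (Matrix.posSemidef_conjTranspose_mul_self _) (hne0 _ hp.1)
    (hF _ (Matrix.posSemidef_conjTranspose_mul_self _) (hne0 _ hp.2))
  have hδD : G p ≤ G q := hmin hq
  have hnorm : ∀ f : Mat n, f.PosSemidef → ∃ (B : Mat n) (a : ℝ),
      B ∈ Metric.sphere (0 : Mat n) 1 ∧ 0 ≤ a ∧ f = a • (Bᴴ * B) := by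
    intro f hf
    obtain ⟨B, rfl⟩ := exists_eq_conjTranspose_mul_self hf
    by_cases hB : B = 0
    · exact ⟨1, 0, by simp, le_rfl, by simp [hB]⟩
    · have hB0 : ‖B‖ ≠ 0 := norm_ne_zero_iff.2 hB
      refine ⟨(‖B‖⁻¹ : ℝ) • B, ‖B‖ ^ 2, ?_, by positivity, ?_⟩
      · rw [mem_sphere_zero_iff_norm, norm_smul, norm_inv, norm_norm, inv_mul_cancel₀ hB0]
      · rw [Matrix.conjTranspose_smul, star_trivial, Matrix.smul_mul, Matrix.mul_smul, smul_smul,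
          smul_smul]
        field_simp
        simp
  have psmul : ∀ (f X : Mat n) (a : ℝ), pair (a • f) X = a * pair f X := by
    intro f X a
    rw [pair_comm, pair_smul, pair_comm]
  refine ⟨G q / G p, (one_le_div hδ).2 hδD, ?_⟩
  intro f g u v hf hg hu hv
  obtain ⟨f, a, hf', ha, rfl⟩ := hnorm f hf
  obtain ⟨g, b, hg', hb, rfl⟩ := hnorm g hg
  obtain ⟨u, c, hu', hc, rfl⟩ := hnorm u hu
  obtain ⟨v, d, hv', hd, rfl⟩ := hnorm v hv
  simp only [map_real_smul, pair_smul, psmul]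
  have b1 : G (f, u) ≤ G q := hmax (Set.mk_mem_prod hf' hu')
  have b2 : G (g, v) ≤ G q := hmax (Set.mk_mem_prod hg' hv')
  have b3 : G p ≤ G (f, v) := hmin (Set.mk_mem_prod hf' hv')
  have b4 : G p ≤ G (g, u) := hmin (Set.mk_mem_prod hg' hu')
  have b5 : G p ≤ G (f, u) := hmin (Set.mk_mem_prod hf' hu')
  have h1 : G (f, u) * G (g, v) ≤ (G q / G p) ^ 2 * (G (f, v) * G (g, u)) := by
    calc G (f, u) * G (g, v) ≤ G q * G q := by
          apply mul_le_mul b1 b2 (hδ.le.trans (hmin (Set.mk_mem_prod hg' hv'))) (hδ.le.trans hδD)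
      _ = (G q / G p) ^ 2 * (G p * G p) := by field_simp
      _ ≤ _ := by
          refine mul_le_mul_of_nonneg_left ?_ (by positivity)
          exact mul_le_mul b3 b4 hδ.le (hδ.le.trans b3)
  have h2 := mul_le_mul_of_nonneg_left h1 (by positivity : 0 ≤ a * b * c * d)
  simp only [hG] at h2 ⊢
  linarith

end Norm

/-- The contraction ratio of a positivity improving map is less than one and bounds the
contraction of all scalings of the map and of its adjoint. -/
theorem PositivityImproving.exists_contraction [NeZero n] {E : MatMap n}
    (hE : PositivityImproving E) :
    ∃ c : ℝ, 0 ≤ c ∧ c < 1 ∧ contractionRatio E = ENNReal.ofReal c ∧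
      ∃ k : ℝ, 1 ≤ k ∧ c = (k - 1) / (k + 1) ∧ CrossRatioBound (k ^ 2) E := by
  obtain ⟨k, hk, hK⟩ := hE.exists_crossRatioBound
  have hc1 : (k - 1) / (k + 1) < 1 := by rw [div_lt_one (by linarith)]; linarith
  have hle := (hK.contracts hk hE).contractionRatio_le
    (div_nonneg (by linarith) (by linarith)) hE.positive
  have hlt : contractionRatio E < 1 := hle.trans_lt (by simpa using hc1)
  have hne : contractionRatio E ≠ ⊤ := (hlt.trans ENNReal.one_lt_top).ne
  -- Compactness only shows that the ratio is below `1`. Feeding the exact ratio back into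
  -- `Contracts.crossRatioBound` gives a `k` that reproduces it, so the final rate is `gamma E`
  -- itself.
  set c := (contractionRatio E).toReal with hc
  have hcE : contractionRatio E = ENNReal.ofReal c := (ENNReal.ofReal_toReal hne).symm
  have hc0 : 0 ≤ c := ENNReal.toReal_nonneg
  have hc1 : c < 1 := by
    rw [hcE] at hlt
    simpa using hlt
  refine ⟨c, hc0, hc1, hcE, (1 + c) / (1 - c), ?_, ?_,
    (contracts_of_contractionRatio_le hc0 hE hcE.le).crossRatioBound hc1 hE⟩
  · rw [one_le_div (by linarith)]; linarith
  · have : 1 - c ≠ 0 := by linarith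
    field_simp
    ring

end OperatorSinkhorn

/-! ### Scalings and the decay of the marginals -/

namespace OperatorSinkhorn

variable {n : ℕ}

section InvSqrt

theorem posDef_sqrt {P : Mat n} (hP : P.PosDef) : (CFC.sqrt P).PosDef :=
  Matrix.isStrictlyPositive_iff_posDef.1 (hP.isStrictlyPositive.sqrt)

theorem posDef_invSqrt {P : Mat n} (hP : P.PosDef) : (invSqrt P).PosDef := (posDef_sqrt hP).inv

theorem invSqrt_inv {P : Mat n} (hP : P.PosDef) : (invSqrt P)⁻¹ = CFC.sqrt P := by
  rw [invSqrt, Matrix.nonsing_inv_nonsing_inv _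
    ((Matrix.isUnit_iff_isUnit_det _).1 (posDef_sqrt hP).isUnit)]

theorem invSqrt_mul_mul_invSqrt {P : Mat n} (hP : P.PosDef) :
    invSqrt P * P * invSqrt P = 1 := by
  have hu := (Matrix.isUnit_iff_isUnit_det _).1 (posDef_sqrt hP).isUnit
  nth_rewrite 2 [← CFC.sqrt_mul_sqrt_self P hP.posSemidef.nonneg]
  rw [invSqrt, ← Matrix.mul_assoc, Matrix.nonsing_inv_mul _ hu, Matrix.one_mul,
    Matrix.mul_nonsing_inv _ hu]

/-- Congruence by `P^{-1/2}` carries the pair `P, 1` to `1, P⁻¹`. -/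
theorem HilbertBound.invSqrt {t : ℝ} {P : Mat n} (hP : P.PosDef) (h : HilbertBound t P 1) :
    HilbertBound t (invSqrt P * invSqrt P) 1 := by
  have h1 := h.conj (OperatorSinkhorn.invSqrt P)
  rw [(posDef_invSqrt hP).1.eq, invSqrt_mul_mul_invSqrt hP, Matrix.mul_one] at h1
  exact h1.symm

end InvSqrt

section Scaling

theorem scaling_apply (E : MatMap n) (X Y A : Mat n) :
    scaling E X Y A = Y * E (X * A * Xᴴ) * Yᴴ := rfl

theorem scaling_scaling (E : MatMap n) (X Y X' Y' : Mat n) :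
    scaling (scaling E X Y) X' Y' = scaling E (X * X') (Y' * Y) := by
  ext1 A
  simp only [scaling_apply, Matrix.conjTranspose_mul, Matrix.mul_assoc]

theorem scaling_one_one (E : MatMap n) : scaling E 1 1 = E := by
  ext1 A
  simp [scaling_apply]

theorem eq_of_trace_conjTranspose_mul {M N : Mat n}
    (h : ∀ A : Mat n, (Mᴴ * A).trace = (Nᴴ * A).trace) : M = N := by
  rw [← sub_eq_zero, ← Matrix.trace_conjTranspose_mul_self_eq_zero_iff]
  conv_lhs => rw [Matrix.conjTranspose_sub, Matrix.sub_mul, Matrix.trace_sub, h, sub_self]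

theorem adjointMap_scaling (E : MatMap n) (X Y B : Mat n) :
    adjointMap (scaling E X Y) B = Xᴴ * adjointMap E (Yᴴ * B * Y) * X := by
  refine eq_of_trace_conjTranspose_mul fun A => ?_
  have h := trace_adjointMap E (X * A * Xᴴ) (Yᴴ * B * Y)
  have e1 : (Bᴴ * scaling E X Y A).trace = ((Yᴴ * B * Y)ᴴ * E (X * A * Xᴴ)).trace := by
    rw [scaling_apply, ← Matrix.mul_assoc, Matrix.trace_mul_comm]
    simp only [Matrix.conjTranspose_mul, Matrix.conjTranspose_conjTranspose, Matrix.mul_assoc]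
  rw [trace_adjointMap, e1, ← h, ← Matrix.mul_assoc, Matrix.trace_mul_comm]
  simp only [Matrix.conjTranspose_mul, Matrix.conjTranspose_conjTranspose, Matrix.mul_assoc]

theorem isUnit_conjTranspose {X : Mat n} (hX : IsUnit X) : IsUnit Xᴴ := hX.star

theorem PositivityImproving.scaling {E : MatMap n} (hE : PositivityImproving E) {X Y : Mat n}
    (hX : IsUnit X) (hY : IsUnit Y) : PositivityImproving (scaling E X Y) := by
  intro A hA hA0
  have h1 : (X * A * Xᴴ) ≠ 0 := by
    rw [Ne, (isUnit_conjTranspose hX).mul_left_eq_zero, hX.mul_right_eq_zero]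
    exact hA0
  exact (Matrix.IsUnit.posDef_star_right_conjugate_iff hY).2 (hE _ (hA.mul_mul_conjTranspose_same X) h1)

theorem PositivityImproving.map_one [NeZero n] {E : MatMap n} (hE : PositivityImproving E) :
    (E 1).PosDef := hE 1 Matrix.PosSemidef.one one_ne_zero

theorem unitalStep_eq [NeZero n] {E : MatMap n} (hE : PositivityImproving E) :
    unitalStep E = scaling E 1 (invSqrt (E 1)) := by
  ext1 A
  simp [scaling_apply, unitalStep, (posDef_invSqrt hE.map_one).1.eq]

theorem traceStep_eq [NeZero n] {E : MatMap n} (hE : PositivityImproving E) :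
    traceStep E = scaling E (invSqrt (adjointMap E 1)) 1 := by
  ext1 A
  simp [scaling_apply, traceStep, (posDef_invSqrt hE.adjointMap.map_one).1.eq]

end Scaling

section Iteration

/-- The product of the right factors of the first `k` rounds of the iteration. -/
noncomputable def rightFactor (E : MatMap n) : ℕ → Mat n
  | 0 => 1
  | k + 1 => rightFactor E k * invSqrt (adjointMap (sinkhorn E (2 * k + 1)) 1)

/-- The adjoint of the product of the left factors of the first `k` rounds of the iteration. -/
noncomputable def leftFactor (E : MatMap n) : ℕ → Mat n
  | 0 => 1
  | k + 1 => leftFactor E k * invSqrt (sinkhorn E (2 * k) 1)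

theorem sinkhorn_odd (E : MatMap n) (k : ℕ) :
    sinkhorn E (2 * k + 1) = unitalStep (sinkhorn E (2 * k)) := by
  rw [sinkhorn, if_pos (even_two_mul k)]

theorem sinkhorn_even (E : MatMap n) (k : ℕ) :
    sinkhorn E (2 * (k + 1)) = traceStep (sinkhorn E (2 * k + 1)) := by
  rw [mul_add, mul_one, sinkhorn, if_neg (by simp)]

variable [NeZero n] {E : MatMap n}

theorem PositivityImproving.unitalStep (hE : PositivityImproving E) :
    PositivityImproving (unitalStep E) := by
  rw [unitalStep_eq hE]
  exact hE.scaling isUnit_one (posDef_invSqrt hE.map_one).isUnit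

theorem PositivityImproving.traceStep (hE : PositivityImproving E) :
    PositivityImproving (traceStep E) := by
  rw [traceStep_eq hE]
  exact hE.scaling (posDef_invSqrt hE.adjointMap.map_one).isUnit isUnit_one

theorem PositivityImproving.sinkhorn (hE : PositivityImproving E) (i : ℕ) :
    PositivityImproving (sinkhorn E i) := by
  induction i with
  | zero => exact hE
  | succ i ih =>
    rw [OperatorSinkhorn.sinkhorn]
    split_ifs
    · exact ih.unitalStep
    · exact ih.traceStep

theorem isUnit_rightFactor (hE : PositivityImproving E) (k : ℕ) : IsUnit (rightFactor E k) := by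
  induction k with
  | zero => exact isUnit_one
  | succ k ih => exact ih.mul (posDef_invSqrt (hE.sinkhorn _).adjointMap.map_one).isUnit

theorem isUnit_leftFactor (hE : PositivityImproving E) (k : ℕ) : IsUnit (leftFactor E k) := by
  induction k with
  | zero => exact isUnit_one
  | succ k ih => exact ih.mul (posDef_invSqrt (hE.sinkhorn _).map_one).isUnit

/-- Left factors accumulate on the left; storing their adjoint makes both products grow on the
right, so one convergence lemma covers both. An odd iterate has one left factor more than right
factors. -/
theorem sinkhorn_eq_scaling (hE : PositivityImproving E) (k : ℕ) :
    sinkhorn E (2 * k) = scaling E (rightFactor E k) (leftFactor E k)ᴴ ∧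
    sinkhorn E (2 * k + 1) = scaling E (rightFactor E k) (leftFactor E (k + 1))ᴴ := by
  have hodd : ∀ k, sinkhorn E (2 * k) = scaling E (rightFactor E k) (leftFactor E k)ᴴ →
      sinkhorn E (2 * k + 1) = scaling E (rightFactor E k) (leftFactor E (k + 1))ᴴ := by
    intro k h
    rw [sinkhorn_odd, unitalStep_eq (hE.sinkhorn _)]
    conv_lhs => rw [h, scaling_scaling, ← h, Matrix.mul_one]
    rw [leftFactor, Matrix.conjTranspose_mul, (posDef_invSqrt (hE.sinkhorn _).map_one).1.eq]
  induction k with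
  | zero =>
    have h0 : sinkhorn E (2 * 0) = scaling E (rightFactor E 0) (leftFactor E 0)ᴴ := by
      simp [rightFactor, leftFactor, scaling_one_one, sinkhorn]
    exact ⟨h0, hodd 0 h0⟩
  | succ k ih =>
    have h0 : sinkhorn E (2 * (k + 1)) =
        scaling E (rightFactor E (k + 1)) (leftFactor E (k + 1))ᴴ := by
      rw [sinkhorn_even, traceStep_eq (hE.sinkhorn _)]
      conv_lhs => rw [ih.2, scaling_scaling, ← ih.2, Matrix.one_mul]
      rw [rightFactor]
    exact ⟨h0, hodd _ h0⟩

theorem unitalStep_one (hE : PositivityImproving E) : unitalStep E 1 = 1 :=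
  invSqrt_mul_mul_invSqrt hE.map_one

theorem adjointMap_traceStep_one (hE : PositivityImproving E) : adjointMap (traceStep E) 1 = 1 := by
  rw [traceStep_eq hE, adjointMap_scaling, (posDef_invSqrt hE.adjointMap.map_one).1.eq]
  simpa using invSqrt_mul_mul_invSqrt hE.adjointMap.map_one

/-- The new adjoint marginal is `E*(E(1)⁻¹)`, to be compared with `E*(1) = 1`. -/
theorem HilbertBound.unitalStep (hE : PositivityImproving E) {c t : ℝ} (ht : 0 ≤ t)
    (hc : Contracts c (adjointMap E)) (h1 : adjointMap E 1 = 1) (h : HilbertBound t (E 1) 1) :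
    HilbertBound (c * t) (adjointMap (unitalStep E) 1) 1 := by
  have hS := posDef_invSqrt hE.map_one
  have hb := h.invSqrt hE.map_one
  have hSS : (OperatorSinkhorn.invSqrt (E 1) * OperatorSinkhorn.invSqrt (E 1)).PosSemidef := by
    simpa [hS.1.eq] using Matrix.posSemidef_conjTranspose_mul_self (OperatorSinkhorn.invSqrt (E 1))
  have := hc t _ _ hSS Matrix.PosSemidef.one ht hb
  rw [h1] at this
  rw [unitalStep_eq hE, adjointMap_scaling, hS.1.eq]
  simpa using this

theorem HilbertBound.traceStep (hE : PositivityImproving E) {c t : ℝ} (ht : 0 ≤ t)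
    (hc : Contracts c E) (h1 : E 1 = 1) (h : HilbertBound t (adjointMap E 1) 1) :
    HilbertBound (c * t) (traceStep E 1) 1 := by
  have hS := posDef_invSqrt hE.adjointMap.map_one
  have hb := h.invSqrt hE.adjointMap.map_one
  have hSS : (OperatorSinkhorn.invSqrt (adjointMap E 1) *
      OperatorSinkhorn.invSqrt (adjointMap E 1)).PosSemidef := by
    simpa [hS.1.eq] using
      Matrix.posSemidef_conjTranspose_mul_self (OperatorSinkhorn.invSqrt (adjointMap E 1))
  have := hc t _ _ hSS Matrix.PosSemidef.one ht hb
  rw [h1] at this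
  rw [traceStep_eq hE, scaling_apply, hS.1.eq]
  simpa using this

theorem CrossRatioBound.sinkhorn (hE : PositivityImproving E) {K : ℝ} (h : CrossRatioBound K E)
    (i : ℕ) : CrossRatioBound K (sinkhorn E i) := by
  induction i with
  | zero => exact h
  | succ i ih =>
    rw [OperatorSinkhorn.sinkhorn]
    split_ifs
    · rw [unitalStep_eq (hE.sinkhorn i)]; exact ih.scaling _ _
    · rw [traceStep_eq (hE.sinkhorn i)]; exact ih.scaling _ _

omit [NeZero n] in
theorem adjointMap_one_of_tracePreserving (htr : TracePreserving E) : adjointMap E 1 = 1 := by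
  refine eq_of_trace_conjTranspose_mul fun A => ?_
  rw [trace_adjointMap, Matrix.conjTranspose_one, Matrix.one_mul, Matrix.one_mul, htr]

theorem adjointMap_sinkhorn_even_one (hE : PositivityImproving E) (htr : TracePreserving E)
    (k : ℕ) : adjointMap (sinkhorn E (2 * k)) 1 = 1 := by
  cases k with
  | zero => exact adjointMap_one_of_tracePreserving htr
  | succ k => rw [sinkhorn_even]; exact adjointMap_traceStep_one (hE.sinkhorn _)

theorem sinkhorn_odd_one (hE : PositivityImproving E) (k : ℕ) : sinkhorn E (2 * k + 1) 1 = 1 := by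
  rw [sinkhorn_odd]; exact unitalStep_one (hE.sinkhorn _)

/-- The marginals of the iterates approach the identity geometrically in Hilbert's metric. -/
theorem hilbertBound_sinkhorn (hE : PositivityImproving E) (htr : TracePreserving E)
    {c t : ℝ} (hc0 : 0 ≤ c) (ht : 0 ≤ t) (hc : ∀ i, Contracts c (sinkhorn E i))
    (hc' : ∀ i, Contracts c (adjointMap (sinkhorn E i))) (h : HilbertBound t (E 1) 1) (k : ℕ) :
    HilbertBound (t * (c ^ 2) ^ k) (sinkhorn E (2 * k) 1) 1 ∧
      HilbertBound (c * t * (c ^ 2) ^ k) (adjointMap (sinkhorn E (2 * k + 1)) 1) 1 := by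
  have hodd : ∀ k, HilbertBound (t * (c ^ 2) ^ k) (sinkhorn E (2 * k) 1) 1 →
      HilbertBound (c * t * (c ^ 2) ^ k) (adjointMap (sinkhorn E (2 * k + 1)) 1) 1 := by
    intro k hk
    rw [sinkhorn_odd, mul_assoc]
    exact hk.unitalStep (hE.sinkhorn _) (by positivity) (hc' _)
      (adjointMap_sinkhorn_even_one hE htr k)
  induction k with
  | zero =>
    have h0 : HilbertBound (t * (c ^ 2) ^ 0) (sinkhorn E (2 * 0) 1) 1 := by
      simpa [sinkhorn] using h
    exact ⟨h0, hodd 0 h0⟩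
  | succ k ih =>
    have h0 : HilbertBound (t * (c ^ 2) ^ (k + 1)) (sinkhorn E (2 * (k + 1)) 1) 1 := by
      have := ih.2.traceStep (hE.sinkhorn _) (by positivity) (hc _) (sinkhorn_odd_one hE k)
      rw [sinkhorn_even]
      convert this using 1
      ring
    exact ⟨h0, hodd _ h0⟩

omit [NeZero n] in
theorem trace_map_one (h : adjointMap E 1 = 1) : (E 1).trace = (1 : Mat n).trace := by
  have := trace_adjointMap E 1 1
  rw [h] at this
  simpa using this.symm

omit [NeZero n] in
theorem trace_adjointMap_one (h : E 1 = 1) : (adjointMap E 1).trace = (1 : Mat n).trace := by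
  have := trace_adjointMap E 1 1
  rw [h] at this
  simp only [Matrix.mul_one, Matrix.trace_conjTranspose, Matrix.conjTranspose_one] at this
  rw [← star_star (adjointMap E 1).trace, this]
  simp

/-- A trace condition turns a projective bound into a two-sided bound. -/
theorem HilbertBound.le_of_trace_eq {t : ℝ} {P : Mat n} (h : HilbertBound t P 1)
    (htr : P.trace = (1 : Mat n).trace) :
    Real.exp (-t) • (1 : Mat n) ≤ P ∧ P ≤ Real.exp t • (1 : Mat n) := by
  obtain ⟨a, ha, h1, h2⟩ := h
  have e : pair 1 P = pair (1 : Mat n) 1 := by simp [pair, htr]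
  have h0 : 0 < pair (1 : Mat n) 1 :=
    pair_pos Matrix.PosSemidef.one one_ne_zero Matrix.PosDef.one
  have i1 := pair_le_pair Matrix.PosSemidef.one h1
  have i2 := pair_le_pair Matrix.PosSemidef.one h2
  rw [pair_smul, e] at i1 i2
  have j1 : a ≤ 1 := le_of_mul_le_mul_right (by linarith) h0
  have j2 : 1 ≤ a * Real.exp t := le_of_mul_le_mul_right (by linarith) h0
  refine ⟨(real_smul_le_smul Matrix.PosSemidef.one ?_).trans h1,
    h2.trans (real_smul_le_smul Matrix.PosSemidef.one ?_)⟩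
  · rw [Real.exp_neg, inv_le_iff_one_le_mul₀ (Real.exp_pos t)]
    exact j2
  · nlinarith [Real.exp_pos t]

end Iteration

end OperatorSinkhorn

/-! ### Convergence of the products of scaling factors -/

namespace OperatorSinkhorn

variable {n : ℕ}

/-- Infinite products with geometrically small deviations from `1` converge. -/
theorem exists_tendsto_of_mul_geometric {A : Type*} [NormedRing A] [CompleteSpace A]
    {Z S : ℕ → A} {C r : ℝ} (hC : 0 ≤ C) (hr0 : 0 ≤ r) (hr1 : r < 1)
    (hZ : ∀ k, Z (k + 1) = Z k * S k) (hS : ∀ k, ‖S k - 1‖ ≤ C * r ^ k) :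
    ∃ L, Tendsto Z atTop (𝓝 L) := by
  have hstep : ∀ k, ‖Z (k + 1) - Z k‖ ≤ ‖Z k‖ * (C * r ^ k) := by
    intro k
    have : Z (k + 1) - Z k = Z k * (S k - 1) := by rw [hZ, mul_sub, mul_one]
    rw [this]
    exact (norm_mul_le _ _).trans (mul_le_mul_of_nonneg_left (hS k) (norm_nonneg _))
  -- Boundedness comes first, from `1 + x ≤ eˣ`; it makes the increments geometric.
  have hbd : ∀ k, ‖Z k‖ ≤ ‖Z 0‖ * Real.exp (C * ∑ j ∈ Finset.range k, r ^ j) := by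
    intro k
    induction k with
    | zero => simp
    | succ k ih =>
      have h1 : ‖Z (k + 1)‖ ≤ ‖Z k‖ * (C * r ^ k + 1) := by
        have := norm_le_norm_add_norm_sub' (Z (k + 1)) (Z k)
        linarith [hstep k]
      calc ‖Z (k + 1)‖ ≤ ‖Z k‖ * (C * r ^ k + 1) := h1
        _ ≤ (‖Z 0‖ * Real.exp (C * ∑ j ∈ Finset.range k, r ^ j)) * Real.exp (C * r ^ k) :=
          mul_le_mul ih (Real.add_one_le_exp _) (by positivity) (by positivity)
        _ = _ := by rw [Finset.sum_range_succ, mul_add, Real.exp_add, mul_assoc]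
  have hbd' : ∀ k, ‖Z k‖ ≤ ‖Z 0‖ * Real.exp (C * (1 - r)⁻¹) := by
    intro k
    refine (hbd k).trans ?_
    have : ∑ j ∈ Finset.range k, r ^ j ≤ (1 - r)⁻¹ := by
      rw [← tsum_geometric_of_lt_one hr0 hr1]
      exact (summable_geometric_of_lt_one hr0 hr1).sum_le_tsum _ fun i _ => pow_nonneg hr0 i
    gcongr
  refine cauchySeq_tendsto_of_complete
    (cauchySeq_of_le_geometric r (‖Z 0‖ * Real.exp (C * (1 - r)⁻¹) * C) hr1 fun k => ?_)
  rw [dist_comm, dist_eq_norm, mul_assoc]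
  exact (hstep k).trans (mul_le_mul_of_nonneg_right (hbd' k) (by positivity))

section Norm

open scoped Matrix.Norms.L2Operator

theorem sqrt_smul_one {a : ℝ} (ha : 0 ≤ a) : CFC.sqrt (a • (1 : Mat n)) = √a • (1 : Mat n) := by
  refine CFC.sqrt_unique ?_ (Matrix.PosSemidef.one.smul (Real.sqrt_nonneg a)).nonneg
  rw [Matrix.smul_mul, Matrix.one_mul, smul_smul, Real.mul_self_sqrt ha]

/-- Operator monotonicity of the square root. -/
theorem le_of_mul_self_le {R : Mat n} (hR : R.PosSemidef) {b : ℝ} (hb : 0 ≤ b)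
    (h : R * R ≤ b • (1 : Mat n)) : R ≤ √b • (1 : Mat n) := by
  have := CFC.sqrt_le_sqrt _ _ h
  rwa [CFC.sqrt_mul_self R hR.nonneg, sqrt_smul_one hb] at this

theorem le_of_le_mul_self {R : Mat n} (hR : R.PosSemidef) {a : ℝ} (ha : 0 ≤ a)
    (h : a • (1 : Mat n) ≤ R * R) : √a • (1 : Mat n) ≤ R := by
  have := CFC.sqrt_le_sqrt _ _ h
  rwa [CFC.sqrt_mul_self R hR.nonneg, sqrt_smul_one ha] at this

theorem sqrt_exp (t : ℝ) : √(Real.exp t) = Real.exp (t / 2) := by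
  rw [Real.sqrt_eq_iff_mul_self_eq_of_pos (Real.exp_pos _), ← Real.exp_add, add_halves]

/-- `d_H(|A|, 1) = d_H(|A|², 1) / 2`. -/
theorem HilbertBound.dH_abs_le {t : ℝ} {A : Mat n} (h : HilbertBound t (Aᴴ * A) 1) :
    dH (CFC.abs A) 1 ≤ ENNReal.ofReal (t / 2) := by
  have hp : (CFC.abs A).PosSemidef := Matrix.nonneg_iff_posSemidef.1 (CFC.abs_nonneg A)
  have e : CFC.abs A * CFC.abs A = Aᴴ * A := CFC.abs_mul_abs A
  obtain ⟨a, ha, h1, h2⟩ := h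
  rw [← e] at h1 h2
  refine HilbertBound.dH_le ⟨√a, Real.sqrt_pos.2 ha, le_of_le_mul_self hp ha.le h1, ?_⟩ hp
    Matrix.PosSemidef.one
  rw [← sqrt_exp, ← Real.sqrt_mul ha.le]
  exact le_of_mul_self_le hp (by positivity) h2

/-- Taking roots gives `e^{-t/2} ≤ R ≤ e^{t/2}`; the constant `3` is crude. The hypotheses concern
`R * R` so that `R` can be either `P^{1/2}` or `P^{-1/2}`. -/
theorem norm_sub_one_le [NeZero n] {R : Mat n} (hR : R.PosSemidef) {t : ℝ} (ht : 0 ≤ t)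
    (h1 : Real.exp (-t) • (1 : Mat n) ≤ R * R) (h2 : R * R ≤ Real.exp t • (1 : Mat n)) :
    ‖R - 1‖ ≤ 3 * t * Real.exp t := by
  have i1 := le_of_le_mul_self hR (Real.exp_pos _).le h1
  have i2 := le_of_mul_self_le hR (Real.exp_pos _).le h2
  rw [sqrt_exp] at i1 i2
  rw [neg_div, Real.exp_neg] at i1
  have hx : 1 ≤ Real.exp (t / 2) := Real.one_le_exp (by linarith)
  have hxt : Real.exp (t / 2) ≤ Real.exp t := Real.exp_le_exp.2 (by linarith)
  have hx2 : Real.exp (t / 2) - 1 ≤ t / 2 * Real.exp (t / 2) := by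
    have e1 := Real.add_one_le_exp (-(t / 2))
    have e2 : Real.exp (-(t / 2)) * Real.exp (t / 2) = 1 := by
      rw [← Real.exp_add, neg_add_cancel, Real.exp_zero]
    nlinarith [Real.exp_pos (t / 2)]
  generalize Real.exp (t / 2) = x at *
  have hx0 : 0 < x := by linarith
  have hxi : x⁻¹ ≤ 1 := inv_le_one_of_one_le₀ hx
  have hD : (R - x⁻¹ • (1 : Mat n)).PosSemidef := Matrix.le_iff.1 i1
  have n1 : ‖R - x⁻¹ • (1 : Mat n)‖ ≤ x - x⁻¹ := by
    refine (CStarAlgebra.norm_le_iff_le_algebraMap _ (by linarith) hD.nonneg).2 ?_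
    rw [Algebra.algebraMap_eq_smul_one, sub_smul]
    exact sub_le_sub_right i2 _
  have n2 : ‖(x⁻¹ - 1) • (1 : Mat n)‖ = 1 - x⁻¹ := by
    rw [norm_smul, norm_one, mul_one, Real.norm_eq_abs, abs_of_nonpos (by linarith)]
    ring
  have e : R - 1 = (R - x⁻¹ • (1 : Mat n)) + (x⁻¹ - 1) • (1 : Mat n) := by module
  have n3 : ‖R - 1‖ ≤ x + 1 - 2 * x⁻¹ := by
    rw [e]
    exact (norm_add_le _ _).trans (by linarith)
  have n4 : x + 1 - 2 * x⁻¹ ≤ 3 * (x - 1) := by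
    have : x * x⁻¹ = 1 := mul_inv_cancel₀ hx0.ne'
    have h3 : x * (3 * (x - 1) - (x + 1 - 2 * x⁻¹)) = 2 * (x - 1) ^ 2 := by
      linear_combination 2 * this
    have h4 : 0 ≤ x * (3 * (x - 1) - (x + 1 - 2 * x⁻¹)) := by rw [h3]; positivity
    linarith [nonneg_of_mul_nonneg_right h4 hx0]
  have h5 : t / 2 * x ≤ t / 2 * Real.exp t := by gcongr
  nlinarith [Real.exp_pos t, mul_nonneg ht (Real.exp_pos t).le]

/-- The scale `a` in the bound may vary along the sequence. Cross inequalities do not mention it and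
are closed conditions. -/
theorem HilbertBound.of_tendsto [NeZero n] {t : ℝ} {P : ℕ → Mat n} {Q : Mat n}
    (h : Tendsto P atTop (𝓝 Q)) (hQ : Q.PosDef) (hP : ∀ᶠ k in atTop, HilbertBound t (P k) 1) :
    HilbertBound t Q 1 := by
  refine hilbertBound_of_cross hQ Matrix.PosDef.one fun f g hf hg => ?_
  have hc : ∀ f : Mat n, Tendsto (fun k => pair f (P k)) atTop (𝓝 (pair f Q)) := by
    intro f
    have : Continuous (pair f) := by
      unfold pair
      fun_prop
    exact (this.tendsto Q).comp h
  refine le_of_tendsto_of_tendsto ((hc f).mul_const _) (((hc g).const_mul _).const_mul _) ?_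
  filter_upwards [hP] with k hk
  exact hk.cross Matrix.PosSemidef.one hf hg

theorem tendsto_conjTranspose {P : ℕ → Mat n} {Q : Mat n} (h : Tendsto P atTop (𝓝 Q)) :
    Tendsto (fun k => (P k)ᴴ) atTop (𝓝 Qᴴ) :=
  ((continuous_star (R := Mat n)).tendsto Q).comp h

/-- Products of inverse square roots of matrices that approach the identity geometrically: they
converge to an invertible matrix, with a bound on the tails. -/
theorem exists_tendsto_prod_invSqrt [NeZero n] {Z P : ℕ → Mat n} {t r : ℝ} (ht : 0 ≤ t)
    (hr0 : 0 ≤ r) (hr1 : r < 1) (hZ0 : Z 0 = 1) (hZ : ∀ k, Z (k + 1) = Z k * invSqrt (P k))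
    (hP : ∀ k, (P k).PosDef) (htr : ∀ k, (P k).trace = (1 : Mat n).trace)
    (hb : ∀ k, HilbertBound (t * r ^ k) (P k) 1) :
    ∃ L : Mat n, Tendsto Z atTop (𝓝 L) ∧ IsUnit L ∧
      ∀ k, HilbertBound (t * r ^ k / (1 - r)) (((Z k)⁻¹ * L)ᴴ * ((Z k)⁻¹ * L)) 1 ∧
        HilbertBound (t * r ^ k / (1 - r)) (((Z k)⁻¹ * L) * ((Z k)⁻¹ * L)ᴴ) 1 := by
  set S : ℕ → Mat n := fun k => invSqrt (P k) with hS
  have hSp : ∀ k, (S k).PosDef := fun k => posDef_invSqrt (hP k)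
  have hSu : ∀ k, IsUnit (S k) := fun k => (hSp k).isUnit
  have hZu : ∀ k, IsUnit (Z k) := by
    intro k
    induction k with
    | zero => rw [hZ0]; exact isUnit_one
    | succ k ih => rw [hZ]; exact ih.mul (hSu k)
  have hdet : ∀ k, IsUnit (Z k).det := fun k => (Matrix.isUnit_iff_isUnit_det _).1 (hZu k)
  have hSb : ∀ k, HilbertBound (t * r ^ k) (S k * S k) 1 := fun k => (hb k).invSqrt (hP k)
  have hrk : ∀ k, t * r ^ k ≤ t := fun k =>
    mul_le_of_le_one_right ht (pow_le_one₀ hr0 hr1.le)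
  have hrk0 : ∀ k, 0 ≤ t * r ^ k := fun k => by positivity
  have hexp : ∀ k, 3 * (t * r ^ k) * Real.exp (t * r ^ k) ≤ 3 * t * Real.exp t * r ^ k := by
    intro k
    have := Real.exp_le_exp.2 (hrk k)
    calc 3 * (t * r ^ k) * Real.exp (t * r ^ k) ≤ 3 * (t * r ^ k) * Real.exp t := by gcongr
      _ = _ := by ring
  have hQn : ∀ k, ‖CFC.sqrt (P k) - 1‖ ≤ 3 * t * Real.exp t * r ^ k := by
    intro k
    obtain ⟨l1, l2⟩ := (hb k).le_of_trace_eq (htr k)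
    rw [← CFC.sqrt_mul_sqrt_self (P k) (hP k).posSemidef.nonneg] at l1 l2
    exact (norm_sub_one_le (posDef_sqrt (hP k)).posSemidef (hrk0 k) l1 l2).trans (hexp k)
  have hSn : ∀ k, ‖S k - 1‖ ≤ 3 * t * Real.exp t * r ^ k := by
    intro k
    obtain ⟨l1, l2⟩ := (hb k).le_of_trace_eq (htr k)
    have c1 := conj_mono (S k) l1
    have c2 := conj_mono (S k) l2
    rw [(hSp k).1.eq, invSqrt_mul_mul_invSqrt (hP k), Matrix.mul_smul, Matrix.mul_one,
      Matrix.smul_mul] at c1 c2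
    refine (norm_sub_one_le (hSp k).posSemidef (hrk0 k) ?_ ?_).trans (hexp k)
    · have := real_smul_le_real_smul_of_le c2 (Real.exp_pos (-(t * r ^ k))).le
      rwa [smul_smul, ← Real.exp_add, neg_add_cancel, Real.exp_zero, one_smul] at this
    · have := real_smul_le_real_smul_of_le c1 (Real.exp_pos (t * r ^ k)).le
      rwa [smul_smul, ← Real.exp_add, add_neg_cancel, Real.exp_zero, one_smul] at this
  have hC : 0 ≤ 3 * t * Real.exp t := by positivity
  obtain ⟨L, hL⟩ := exists_tendsto_of_mul_geometric hC hr0 hr1 hZ hSn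
  -- Conjugate transposes of the inverses satisfy the same recursion with factors `P^{1/2}`. Their
  -- limit yields an inverse of `L`.
  obtain ⟨L', hL'⟩ := exists_tendsto_of_mul_geometric (Z := fun k => ((Z k)⁻¹)ᴴ) hC hr0 hr1
    (fun k => by
      rw [hZ, Matrix.mul_inv_rev, Matrix.conjTranspose_mul, invSqrt_inv (hP k),
        (posDef_sqrt (hP k)).1.eq]) hQn
  have hLL : L * L'ᴴ = 1 := by
    refine tendsto_nhds_unique (hL.mul (tendsto_conjTranspose hL')) ?_
    have : (fun k => Z k * (((Z k)⁻¹)ᴴ)ᴴ) = fun _ => (1 : Mat n) := by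
      funext k
      rw [Matrix.conjTranspose_conjTranspose, Matrix.mul_nonsing_inv _ (hdet k)]
    rw [this]
    exact tendsto_const_nhds
  have hLu : IsUnit L := IsUnit.of_mul_eq_one _ hLL
  refine ⟨L, hL, hLu, fun k => ?_⟩
  have hr' : 0 < 1 - r := by linarith
  have hsum : ∀ m, t * (r ^ k - r ^ (k + m)) / (1 - r) + t * r ^ (k + m) =
      t * (r ^ k - r ^ (k + (m + 1))) / (1 - r) := by
    intro m
    rw [div_add' _ _ _ hr'.ne']
    congr 1
    ring
  -- The bound is the partial sum of `t r^j` over `k ≤ j < k + m`. With `A` the product so far, `S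
  -- AᴴA S` is compared with `S²`, and `A S² Aᴴ` with `A Aᴴ`. The right and left factors need
  -- different orders.
  have hfin : ∀ m, HilbertBound (t * (r ^ k - r ^ (k + m)) / (1 - r))
      (((Z k)⁻¹ * Z (k + m))ᴴ * ((Z k)⁻¹ * Z (k + m))) 1 ∧
      HilbertBound (t * (r ^ k - r ^ (k + m)) / (1 - r))
      (((Z k)⁻¹ * Z (k + m)) * ((Z k)⁻¹ * Z (k + m))ᴴ) 1 := by
    intro m
    induction m with
    | zero =>
      have h0 : HilbertBound 0 (1 : Mat n) 1 := by simpa using HilbertBound.of_smul one_pos (1 : Mat n)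
      rw [add_zero, Matrix.nonsing_inv_mul _ (hdet k)]
      simpa using h0
    | succ m ih =>
      have e : (Z k)⁻¹ * Z (k + (m + 1)) = ((Z k)⁻¹ * Z (k + m)) * S (k + m) := by
        rw [← add_assoc, hZ, Matrix.mul_assoc]
      rw [e, ← hsum]
      generalize (Z k)⁻¹ * Z (k + m) = A at ih
      constructor
      · have h1 := ih.1.conj (S (k + m))
        rw [(hSp _).1.eq, Matrix.mul_one] at h1
        rw [Matrix.conjTranspose_mul, (hSp _).1.eq]
        have := h1.trans (hSb (k + m))
        simpa only [Matrix.mul_assoc] using this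
      · have h1 := (hSb (k + m)).conj A
        rw [Matrix.mul_one] at h1
        rw [Matrix.conjTranspose_mul, (hSp _).1.eq, add_comm]
        have := h1.trans ih.2
        simpa only [Matrix.mul_assoc] using this
  have hmono : ∀ m, t * (r ^ k - r ^ (k + m)) / (1 - r) ≤ t * r ^ k / (1 - r) := by
    intro m
    have : 0 ≤ r ^ (k + m) := by positivity
    gcongr
    linarith
  have hlim : Tendsto (fun m => (Z k)⁻¹ * Z (k + m)) atTop (𝓝 ((Z k)⁻¹ * L)) := by
    have : Tendsto (fun m => Z (k + m)) atTop (𝓝 L) := by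
      simpa only [add_comm] using (tendsto_add_atTop_iff_nat k).2 hL
    exact this.const_mul _
  have hu : IsUnit ((Z k)⁻¹ * L) :=
    ((Matrix.isUnit_nonsing_inv_iff).2 (hZu k)).mul hLu
  have hs := tendsto_conjTranspose hlim
  constructor
  · refine HilbertBound.of_tendsto (hs.mul hlim) ?_ (Eventually.of_forall fun m =>
      (hfin m).1.mono Matrix.PosSemidef.one (hmono m))
    exact Matrix.PosDef.conjTranspose_mul_self _ (Matrix.mulVec_injective_of_isUnit hu)
  · refine HilbertBound.of_tendsto (hlim.mul hs) ?_ (Eventually.of_forall fun m =>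
      (hfin m).2.mono Matrix.PosSemidef.one (hmono m))
    exact Matrix.PosDef.mul_conjTranspose_self _ (Matrix.vecMul_injective_of_isUnit hu)

end Norm

end OperatorSinkhorn

/-! ### Uniqueness up to unitaries -/

namespace OperatorSinkhorn

variable {n : ℕ}

theorem HilbertBound.inv {t : ℝ} {P : Mat n} (hP : P.PosDef) (h : HilbertBound t P 1) :
    HilbertBound t P⁻¹ 1 := by
  have := h.invSqrt hP
  rwa [OperatorSinkhorn.invSqrt, ← Matrix.mul_inv_rev,
    CFC.sqrt_mul_sqrt_self P hP.posSemidef.nonneg] at this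

theorem tendsto_of_even_odd {α : Type*} {l : Filter α} {f : ℕ → α}
    (h0 : Tendsto (fun k => f (2 * k)) atTop l) (h1 : Tendsto (fun k => f (2 * k + 1)) atTop l) :
    Tendsto f atTop l := by
  intro s hs
  obtain ⟨a, ha⟩ := mem_atTop_sets.1 (h0 hs)
  obtain ⟨b, hb⟩ := mem_atTop_sets.1 (h1 hs)
  refine mem_atTop_sets.2 ⟨2 * (a + b) + 1, fun i hi => ?_⟩
  rcases Nat.even_or_odd' i with ⟨k, rfl | rfl⟩
  · exact ha k (by lia)
  · exact hb k (by lia)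

theorem tendsto_scaling (E : MatMap n) {X Y : ℕ → Mat n} {X' Y' : Mat n}
    (hX : Tendsto X atTop (𝓝 X')) (hY : Tendsto Y atTop (𝓝 Y')) (A : Mat n) :
    Tendsto (fun k => scaling E (X k) (Y k)ᴴ A) atTop (𝓝 (scaling E X' Y'ᴴ A)) := by
  have hE : Continuous E := E.continuous_of_finiteDimensional
  have h1 := (hE.tendsto _).comp ((hX.mul_const A).mul (tendsto_conjTranspose hX))
  have hY' := tendsto_conjTranspose hY
  simp only [scaling_apply]
  exact (hY'.mul h1).mul (tendsto_conjTranspose hY')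

section Uniqueness

variable [NeZero n] {T : MatMap n}

/-- A doubly stochastic scaling of a contracting doubly stochastic map differs from it by
unitaries. -/
theorem exists_unitary_of_doublyStochastic (hT : PositivityImproving T) {c : ℝ} (hc0 : 0 ≤ c)
    (hc1 : c < 1) (hcT : Contracts c T) (hcT' : Contracts c (adjointMap T))
    (hd : DoublyStochastic T) {Z W : Mat n} (h : DoublyStochastic (scaling T Z W)) :
    ∃ U ∈ Matrix.unitaryGroup (Fin n) ℂ, ∃ V ∈ Matrix.unitaryGroup (Fin n) ℂ,
      scaling T Z W = scaling T V U := by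
  obtain ⟨h1, h2⟩ := h
  rw [scaling_apply, Matrix.mul_one] at h1
  rw [adjointMap_scaling, Matrix.mul_one] at h2
  have hZ : IsUnit Z := IsUnit.of_mul_eq_one_right _ h2
  have hW : IsUnit W := by
    rw [Matrix.mul_assoc] at h1
    exact IsUnit.of_mul_eq_one _ h1
  have hP : (Z * Zᴴ).PosDef :=
    Matrix.PosDef.mul_conjTranspose_self _ (Matrix.vecMul_injective_of_isUnit hZ)
  have hQ : (Wᴴ * W).PosDef :=
    Matrix.PosDef.conjTranspose_mul_self _ (Matrix.mulVec_injective_of_isUnit hW)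
  have e1 : T (Z * Zᴴ) * (Wᴴ * W) = 1 := by
    rw [← Matrix.mul_assoc, mul_eq_one_comm, ← Matrix.mul_assoc]
    exact h1
  have e2 : adjointMap T (Wᴴ * W) * (Z * Zᴴ) = 1 := by
    rw [← Matrix.mul_assoc, mul_eq_one_comm, ← Matrix.mul_assoc]
    exact h2
  -- Round trip `P ↦ T(P) = Q⁻¹ ↦ Q ↦ T*(Q) = P⁻¹ ↦ P`: each map contracts by `c`, each inversion is
  -- an isometry relative to `1`.
  have step : ∀ t : ℝ, 0 ≤ t → HilbertBound t (Z * Zᴴ) 1 →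
      HilbertBound (c * (c * t)) (Z * Zᴴ) 1 := by
    intro t ht hb
    have b1 := hcT t _ _ hP.posSemidef Matrix.PosSemidef.one ht hb
    rw [hd.1] at b1
    have b2 := b1.inv (hT _ hP.posSemidef hP.isUnit.ne_zero)
    rw [Matrix.inv_eq_right_inv e1] at b2
    have b3 := hcT' _ _ _ hQ.posSemidef Matrix.PosSemidef.one (by positivity) b2
    rw [hd.2] at b3
    have b4 := b3.inv (hT.adjointMap _ hQ.posSemidef hQ.isUnit.ne_zero)
    rwa [Matrix.inv_eq_right_inv e2] at b4
  obtain ⟨t, ht, hb⟩ := exists_hilbertBound_one hP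
  have hfin : dH (Z * Zᴴ) 1 ≠ ⊤ :=
    ne_top_of_le_ne_top ENNReal.ofReal_ne_top (hb.dH_le hP.posSemidef Matrix.PosSemidef.one)
  have hne : ¬(Z * Zᴴ = 0 ∧ (1 : Mat n) = 0) := fun hh => one_ne_zero hh.2
  have hs0 : 0 ≤ (dH (Z * Zᴴ) 1).toReal := ENNReal.toReal_nonneg
  have hb0 := hilbertBound_of_dH_le hne hs0 (ENNReal.ofReal_toReal hfin).ge
  have hb1 := (step _ hs0 hb0).dH_le hP.posSemidef Matrix.PosSemidef.one
  have hle := ENNReal.toReal_le_of_le_ofReal (by positivity) hb1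
  have hz : (dH (Z * Zᴴ) 1).toReal = 0 := by
    have : c * (c * (dH (Z * Zᴴ) 1).toReal) ≤ c * (dH (Z * Zᴴ) 1).toReal := by
      have : c * (dH (Z * Zᴴ) 1).toReal ≤ 1 * (dH (Z * Zᴴ) 1).toReal := by gcongr
      rw [one_mul] at this
      gcongr
    nlinarith
  rw [hz] at hb0
  obtain ⟨a, ha, hPa⟩ := hb0.eq_smul
  have hQa : a • (Wᴴ * W) = 1 := by
    rw [hPa, map_real_smul, hd.1, Matrix.smul_mul, Matrix.one_mul] at e1
    exact e1
  have hs : √a * √a = a := Real.mul_self_sqrt ha.le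
  have hsp : √a ≠ 0 := (Real.sqrt_pos.2 ha).ne'
  -- Now `Z Zᴴ = a` and `Wᴴ W = a⁻¹`; the reciprocal rescalings cancel in the scaled map.
  refine ⟨√a • W, ?_, (√a)⁻¹ • Z, ?_, ?_⟩
  · rw [Matrix.mem_unitaryGroup_iff', Matrix.star_eq_conjTranspose, Matrix.conjTranspose_smul,
      star_trivial, Matrix.smul_mul, Matrix.mul_smul, smul_smul, hs, hQa]
  · rw [Matrix.mem_unitaryGroup_iff, Matrix.star_eq_conjTranspose, Matrix.conjTranspose_smul,
      star_trivial, Matrix.smul_mul, Matrix.mul_smul, smul_smul, hPa, smul_smul, ← mul_inv, hs,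
      inv_mul_cancel₀ ha.ne', one_smul]
  · ext1 A
    simp only [scaling_apply, Matrix.conjTranspose_smul, star_trivial, Matrix.smul_mul,
      Matrix.mul_smul, smul_smul, map_real_smul]
    have : √a * ((√a)⁻¹ * (√a)⁻¹ * √a) = 1 := by field_simp
    rw [this, one_smul]

end Uniqueness

theorem scalingDist_le {F T : MatMap n} {X Y : Mat n} (hX : IsUnit X) (hY : IsUnit Y)
    (h : T = scaling F X Y) {s t : ℝ} (hs : HilbertBound s (Xᴴ * X) 1)
    (ht : HilbertBound t (Yᴴ * Y) 1) :
    scalingDist F T ≤ ENNReal.ofReal (s / 2) + ENNReal.ofReal (t / 2) := by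
  refine le_trans ?_ (add_le_add hs.dH_abs_le ht.dH_abs_le)
  unfold scalingDist
  refine iInf_le_of_le X ?_
  refine iInf_le_of_le Y ?_
  exact iInf_le_of_le hX (iInf_le_of_le hY (iInf_le_of_le h le_rfl))

end OperatorSinkhorn

/-- All distances vanish in dimension zero, so the supremum is empty. -/
theorem OperatorSinkhorn.gamma_of_subsingleton (E : OperatorSinkhorn.MatMap 0) :
    OperatorSinkhorn.gamma E = 0 := by
  have : OperatorSinkhorn.contractionRatio E = 0 := by
    simp only [OperatorSinkhorn.contractionRatio, ENNReal.iSup_eq_zero]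
    intro x y _ _ h
    exact absurd (by simp [OperatorSinkhorn.dH, Subsingleton.elim _ (0 : OperatorSinkhorn.Mat 0)]) h
  simp [OperatorSinkhorn.gamma, this]

/-! ### Error bounds and assembly -/

namespace OperatorSinkhorn

variable {n : ℕ} [NeZero n] {E : MatMap n}

omit [NeZero n] in
theorem tracePreserving_of_adjointMap_one (h : adjointMap E 1 = 1) : TracePreserving E := by
  intro A
  have := trace_adjointMap E A 1
  rw [h] at this
  simpa using this.symm

/-- The limit is a scaling of each iterate by the tails of the two products. Passing from `|X|²` to
`|X|` halves distances, so the tails contribute `(1 + c) / 2 ≤ 1` times the bound. Allowing `j ≥ k`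
left factors covers odd iterates. -/
theorem scalingDist_sinkhorn_le (hE : PositivityImproving E) {c t : ℝ} (hc0 : 0 ≤ c) (hc1 : c < 1)
    (ht : 0 ≤ t) {X L : Mat n} (hX : IsUnit X) (hL : IsUnit L)
    (hXb : ∀ k, HilbertBound (c * t * (c ^ 2) ^ k / (1 - c ^ 2))
      (((rightFactor E k)⁻¹ * X)ᴴ * ((rightFactor E k)⁻¹ * X)) 1)
    (hLb : ∀ k, HilbertBound (t * (c ^ 2) ^ k / (1 - c ^ 2))
      (((leftFactor E k)⁻¹ * L) * ((leftFactor E k)⁻¹ * L)ᴴ) 1) (k : ℕ) :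
    scalingDist (sinkhorn E (2 * k)) (scaling E X Lᴴ) ≤
        ENNReal.ofReal ((c ^ 2) ^ k / (1 - c ^ 2) * t) ∧
      scalingDist (sinkhorn E (2 * k + 1)) (scaling E X Lᴴ) ≤
        ENNReal.ofReal ((c ^ 2) ^ k / (1 - c ^ 2) * t) := by
  have hr1 : c ^ 2 < 1 := by nlinarith
  have hr : 0 < 1 - c ^ 2 := by linarith
  have key : ∀ (k j : ℕ), k ≤ j → scalingDist (scaling E (rightFactor E k) (leftFactor E j)ᴴ)
      (scaling E X Lᴴ) ≤ ENNReal.ofReal ((c ^ 2) ^ k / (1 - c ^ 2) * t) := by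
    intro k j hkj
    have hRu := isUnit_rightFactor hE k
    have hLu := isUnit_leftFactor hE j
    have h1 : IsUnit ((rightFactor E k)⁻¹ * X) := (Matrix.isUnit_nonsing_inv_iff.2 hRu).mul hX
    have h2 : IsUnit ((leftFactor E j)⁻¹ * L) := (Matrix.isUnit_nonsing_inv_iff.2 hLu).mul hL
    have hT : scaling E X Lᴴ = scaling (scaling E (rightFactor E k) (leftFactor E j)ᴴ)
        ((rightFactor E k)⁻¹ * X) ((leftFactor E j)⁻¹ * L)ᴴ := by
      rw [scaling_scaling, ← Matrix.conjTranspose_mul,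
        Matrix.mul_nonsing_inv_cancel_left _ _ ((Matrix.isUnit_iff_isUnit_det _).1 hRu),
        Matrix.mul_nonsing_inv_cancel_left _ _ ((Matrix.isUnit_iff_isUnit_det _).1 hLu)]
    have hLj := hLb j
    have hpow : (c ^ 2) ^ j ≤ (c ^ 2) ^ k := pow_le_pow_of_le_one (by positivity) hr1.le hkj
    have hLk := hLj.mono (t := t * (c ^ 2) ^ k / (1 - c ^ 2)) Matrix.PosSemidef.one (by gcongr)
    refine (scalingDist_le h1 (isUnit_conjTranspose h2) hT (hXb k)
      (by rwa [Matrix.conjTranspose_conjTranspose])).trans ?_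
    rw [← ENNReal.ofReal_add (by positivity) (by positivity)]
    refine ENNReal.ofReal_le_ofReal ?_
    have hB : 0 ≤ (c ^ 2) ^ k / (1 - c ^ 2) * t := by positivity
    have e : c * t * (c ^ 2) ^ k / (1 - c ^ 2) / 2 + t * (c ^ 2) ^ k / (1 - c ^ 2) / 2 =
      (1 + c) / 2 * ((c ^ 2) ^ k / (1 - c ^ 2) * t) := by ring
    rw [e]
    exact mul_le_of_le_one_left hB (by linarith)
  obtain ⟨e1, e2⟩ := sinkhorn_eq_scaling hE k
  exact ⟨e1 ▸ key k k le_rfl, e2 ▸ key k (k + 1) (Nat.le_succ k)⟩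

/-- The operator Sinkhorn iteration converges geometrically to a doubly stochastic scaling. -/
theorem exists_doublyStochastic_limit (hE : PositivityImproving E) (htr : TracePreserving E) :
    ∃ T : MatMap n, DoublyStochastic T ∧
      (∃ X Y : Mat n, IsUnit X ∧ IsUnit Y ∧ T = scaling E X Y) ∧
      (∀ X Y : Mat n, DoublyStochastic (scaling E X Y) →
        ∃ U ∈ Matrix.unitaryGroup (Fin n) ℂ, ∃ V ∈ Matrix.unitaryGroup (Fin n) ℂ,
          scaling E X Y = scaling T V U) ∧
      (∀ A : Mat n, Tendsto (fun i => sinkhorn E i A) atTop (𝓝 (T A))) ∧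
      gamma E < 1 ∧
      ∀ j ∈ ({1, 3} : Set ℕ), ∀ ρ σ : Mat n, ρ = E 1 → σ = adjointMap (sinkhorn E j) 1 →
        dH ρ 1 < ⊤ ∧ dH σ 1 < ⊤ ∧ ∀ k : ℕ,
          scalingDist (sinkhorn E (2 * k)) T ≤
            gamma E ^ k / (1 - gamma E) * (dH ρ 1 + dH σ 1) ∧
          scalingDist (sinkhorn E (2 * k + 1)) T ≤
            gamma E ^ k / (1 - gamma E) * (dH ρ 1 + dH σ 1) := by
  obtain ⟨c, hc0, hc1, hcE, κ, hκ, rfl, hK⟩ := hE.exists_contraction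
  set c := (κ - 1) / (κ + 1) with hc
  have hr0 : 0 ≤ c ^ 2 := by positivity
  have hr1 : c ^ 2 < 1 := by nlinarith
  have hcon : ∀ F : MatMap n, PositivityImproving F → CrossRatioBound (κ ^ 2) F →
      Contracts c F ∧ Contracts c (adjointMap F) := fun F hF h =>
    ⟨h.contracts hκ hF, (h.adjointMap hF.positive).contracts hκ hF.adjointMap⟩
  have hdfin : ∀ P : Mat n, P.PosDef → dH P 1 < ⊤ := by
    intro P hP
    obtain ⟨t, -, hb⟩ := exists_hilbertBound_one hP
    exact (hb.dH_le hP.posSemidef Matrix.PosSemidef.one).trans_lt ENNReal.ofReal_lt_top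
  have hρfin := hdfin _ hE.map_one
  set t := (dH (E 1) 1).toReal with ht
  have ht0 : 0 ≤ t := ENNReal.toReal_nonneg
  have hρt : dH (E 1) 1 = ENNReal.ofReal t := (ENNReal.ofReal_toReal hρfin.ne).symm
  have hb0 : HilbertBound t (E 1) 1 :=
    hilbertBound_of_dH_le (fun hh => one_ne_zero hh.2) ht0 hρt.le
  have hb := hilbertBound_sinkhorn hE htr hc0 ht0
    (fun i => (hcon _ (hE.sinkhorn i) (hK.sinkhorn hE i)).1)
    (fun i => (hcon _ (hE.sinkhorn i) (hK.sinkhorn hE i)).2) hb0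
  obtain ⟨X, hX, hXu, hXb⟩ := exists_tendsto_prod_invSqrt (Z := rightFactor E)
    (P := fun k => adjointMap (sinkhorn E (2 * k + 1)) 1) (mul_nonneg hc0 ht0) hr0 hr1 rfl
    (fun _ => rfl) (fun k => (hE.sinkhorn _).adjointMap.map_one)
    (fun k => trace_adjointMap_one (sinkhorn_odd_one hE k)) (fun k => (hb k).2)
  obtain ⟨L, hL, hLu, hLb⟩ := exists_tendsto_prod_invSqrt (Z := leftFactor E)
    (P := fun k => sinkhorn E (2 * k) 1) ht0 hr0 hr1 rfl
    (fun _ => rfl) (fun k => (hE.sinkhorn _).map_one)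
    (fun k => trace_map_one (adjointMap_sinkhorn_even_one hE htr k)) (fun k => (hb k).1)
  have hY : IsUnit Lᴴ := isUnit_conjTranspose hLu
  have heven : ∀ A, Tendsto (fun k => sinkhorn E (2 * k) A) atTop (𝓝 (scaling E X Lᴴ A)) := by
    intro A
    simp only [(sinkhorn_eq_scaling hE _).1]
    exact tendsto_scaling E hX hL A
  have hodd : ∀ A, Tendsto (fun k => sinkhorn E (2 * k + 1) A) atTop (𝓝 (scaling E X Lᴴ A)) := by
    intro A
    simp only [(sinkhorn_eq_scaling hE _).2]
    exact tendsto_scaling E hX ((tendsto_add_atTop_iff_nat 1).2 hL) A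
  have hd : DoublyStochastic (scaling E X Lᴴ) := by
    refine ⟨tendsto_nhds_unique (hodd 1) ?_, adjointMap_one_of_tracePreserving fun A => ?_⟩
    · simp only [sinkhorn_odd_one hE]
      exact tendsto_const_nhds
    -- The second marginal is obtained as trace preservation, which passes to pointwise limits
    -- without involving the adjoint.
    · have h1 : Tendsto (fun k => (sinkhorn E (2 * k) A).trace) atTop
          (𝓝 (scaling E X Lᴴ A).trace) :=
        ((continuous_id.matrix_trace).tendsto _).comp (heven A)
      refine tendsto_nhds_unique h1 ?_
      simp only [tracePreserving_of_adjointMap_one (adjointMap_sinkhorn_even_one hE htr _) A]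
      exact tendsto_const_nhds
  have hTp := hE.scaling hXu hY
  have hTc := hcon _ hTp (hK.scaling X Lᴴ)
  have hg : gamma E = ENNReal.ofReal (c ^ 2) := by
    rw [gamma, hcE, ENNReal.ofReal_pow hc0]
  refine ⟨scaling E X Lᴴ, hd, ⟨X, Lᴴ, hXu, hY, rfl⟩, fun X' Y' h' => ?_,
    fun A => tendsto_of_even_odd (heven A) (hodd A), ?_, ?_⟩
  -- `X` and `L` are invertible, so any scaling of `E` is one of the limit; invertibility of `X'`
  -- and `Y'` is not needed here.
  · have e : scaling E X' Y' = scaling (scaling E X Lᴴ) (X⁻¹ * X') (Y' * (Lᴴ)⁻¹) := by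
      rw [scaling_scaling,
        Matrix.mul_nonsing_inv_cancel_left _ _ ((Matrix.isUnit_iff_isUnit_det _).1 hXu),
        Matrix.nonsing_inv_mul_cancel_right _ _ ((Matrix.isUnit_iff_isUnit_det _).1 hY)]
    rw [e] at h' ⊢
    exact exists_unitary_of_doublyStochastic hTp hc0 hc1 hTc.1 hTc.2 hd h'
  · rw [hg]
    simpa using hr1
  · rintro j - ρ σ rfl rfl
    refine ⟨hρfin, hdfin _ (hE.sinkhorn j).adjointMap.map_one, fun k => ?_⟩
    -- The term with `d_H(E(1), 1)` already suffices. The `σ` term is only added slack, which is why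
    -- both choices of `j` work.
    have hrhs : ENNReal.ofReal ((c ^ 2) ^ k / (1 - c ^ 2) * t) ≤ gamma E ^ k / (1 - gamma E) *
        (dH (E 1) 1 + dH (adjointMap (sinkhorn E j) 1) 1) := by
      have hr : 0 < 1 - c ^ 2 := by linarith
      rw [ENNReal.ofReal_mul (by positivity), ENNReal.ofReal_div_of_pos hr,
        ENNReal.ofReal_pow hr0, ENNReal.ofReal_sub _ hr0, ENNReal.ofReal_one, ← hg, ← hρt]
      gcongr
      exact le_self_add
    have := scalingDist_sinkhorn_le hE hc0 hc1 ht0 hXu hLu (fun k => (hXb k).1)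
      (fun k => (hLb k).2) k
    exact ⟨this.1.trans hrhs, this.2.trans hrhs⟩

end OperatorSinkhorn

theorem mainTheorem8 (n : ℕ) (E : OperatorSinkhorn.MatMap n)
    (hE : OperatorSinkhorn.PositivityImproving E)
    (htr : OperatorSinkhorn.TracePreserving E) :
    ∃ T : OperatorSinkhorn.MatMap n,
      -- `T` is a doubly stochastic scaling of `E`, unique up to unitaries
      OperatorSinkhorn.DoublyStochastic T ∧
      (∃ X Y : OperatorSinkhorn.Mat n, IsUnit X ∧ IsUnit Y ∧
        T = OperatorSinkhorn.scaling E X Y) ∧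
      (∀ X Y : OperatorSinkhorn.Mat n,
        OperatorSinkhorn.DoublyStochastic (OperatorSinkhorn.scaling E X Y) →
        ∃ U ∈ Matrix.unitaryGroup (Fin n) ℂ, ∃ V ∈ Matrix.unitaryGroup (Fin n) ℂ,
          OperatorSinkhorn.scaling E X Y = OperatorSinkhorn.scaling T V U) ∧
      -- the iterates converge to `T`
      (∀ A : OperatorSinkhorn.Mat n,
        Tendsto (fun i => OperatorSinkhorn.sinkhorn E i A) atTop (𝓝 (T A))) ∧
      -- the rate is geometric, for `σ = (E_1)*(1)` and for `σ = (E_3)*(1)`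
      OperatorSinkhorn.gamma E < 1 ∧
      ∀ j ∈ ({1, 3} : Set ℕ), ∀ ρ σ : OperatorSinkhorn.Mat n,
        ρ = E 1 → σ = OperatorSinkhorn.adjointMap (OperatorSinkhorn.sinkhorn E j) 1 →
        OperatorSinkhorn.dH ρ 1 < ⊤ ∧ OperatorSinkhorn.dH σ 1 < ⊤ ∧
        ∀ k : ℕ,
          OperatorSinkhorn.scalingDist (OperatorSinkhorn.sinkhorn E (2 * k)) T ≤
            OperatorSinkhorn.gamma E ^ k / (1 - OperatorSinkhorn.gamma E) *
              (OperatorSinkhorn.dH ρ 1 + OperatorSinkhorn.dH σ 1) ∧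
          OperatorSinkhorn.scalingDist (OperatorSinkhorn.sinkhorn E (2 * k + 1)) T ≤
            OperatorSinkhorn.gamma E ^ k / (1 - OperatorSinkhorn.gamma E) *
              (OperatorSinkhorn.dH ρ 1 + OperatorSinkhorn.dH σ 1) := by
  -- The general argument uses `1 ≠ 0`; in dimension zero there is only one matrix.
  rcases Nat.eq_zero_or_pos n with rfl | hn
  · have hd : ∀ x y : OperatorSinkhorn.Mat 0, OperatorSinkhorn.dH x y = 0 := fun x y => by
      simp [OperatorSinkhorn.dH, Subsingleton.elim _ (0 : OperatorSinkhorn.Mat 0)]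
    have hdist : ∀ F G : OperatorSinkhorn.MatMap 0, OperatorSinkhorn.scalingDist F G = 0 :=
      fun F G => le_antisymm (iInf_le_of_le 1 <| iInf_le_of_le 1 <| iInf_le_of_le isUnit_one <|
        iInf_le_of_le isUnit_one <| iInf_le_of_le (LinearMap.ext fun _ => Subsingleton.elim _ _) <|
        by simp [hd]) bot_le
    refine ⟨E, ⟨Subsingleton.elim _ _, Subsingleton.elim _ _⟩,
      ⟨1, 1, isUnit_one, isUnit_one, (OperatorSinkhorn.scaling_one_one E).symm⟩,
      fun X Y _ => ⟨1, one_mem _, 1, one_mem _, LinearMap.ext fun _ => Subsingleton.elim _ _⟩,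
      fun A => ?_, by simp [OperatorSinkhorn.gamma_of_subsingleton], fun j _ ρ σ _ _ => ?_⟩
    · rw [show (fun i => OperatorSinkhorn.sinkhorn E i A) = fun _ => E A from
        funext fun _ => Subsingleton.elim _ _]
      exact tendsto_const_nhds
    · simp [hd, hdist]
  have : NeZero n := ⟨hn.ne'⟩
  exact OperatorSinkhorn.exists_doublyStochastic_limit hE htr
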